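/- All graphs are finite and simple. The spectrum of a graph is the multiset of eigenvalues of its adjacency matrix $A$. Two graphs are cospectral if they have the same spectrum, and a graph is DS (determined by its spectrum) if every graph cospectral with it is isomorphic to it. For a graph $H$ with at most $n$ vertices, $K_n\setminus H$ denotes the graph obtained from $K_n$ by deleting the edges of a copy of $H$; $+$ denotes disjoint union, and $P_6$ is the path on six vertices. 1. Let $G$ be obtained from $K_n$ by removing at most five edges. Then $G$ is DS if and only if $G$ is neither $K_7\setminus(K_4\setminus K_2)$ nor $K_7\setminus(K_{1,4}+K_2)$. These two graphs are cospectral and not isomorphic. 2. For $n\ge 8$ exactly eleven nonisomorphic graphs are obtained by removing four edges from $K_n$. For every $n$, any two graphs obtained from $K_n$ by removing four edges that have the same number of triangles and the same number of closed walks of length $4$ are isomorphic. 3. For $n\ge 10$ exactly 26 nonisomorphic graphs are obtained by removing five edges from $K_n$. For every $n$, two nonisomorphic graphs $G,G'$ obtained from $K_n$ by removing five edges have the same number of triangles and the same number of closed walks of length $4$ if and only if either $n=7$ and $\{G,G'\}=\{K_7\setminus(K_4\setminus K_2),\,K_7\setminus(K_{1,4}+K_2)\}$, or $\{G,G'\}=\{K_n\setminus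 P_6,\,K_n\setminus(C_4+K_2)\}$. 4. For $n>7$ the matrix $A+I$ has rank $4$ for $K_n\setminus(K_4\setminus K_2)$ and rank $5$ for $K_n\setminus(K_{1,4}+K_2)$; that is, $-1$ is an eigenvalue of multiplicity $n-4$ and $n-5$, respectively. For every $n\ge 6$ the graphs $K_n\setminus P_6$ and $K_n\setminus(C_4+K_2)$ have different ranks of $A+I$ and different multiplicities of the eigenvalue $-1$ (where multiplicity $0$ means that $-1$ is not an eigenvalue). -/

import Mathlib

namespace SimpleGraph

open Classical in
/-- The adjacency spectrum: the multiset of the eigenvalues of the (real symmetric) adjacency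
matrix, each with its multiplicity as a root of the characteristic polynomial. -/
noncomputable def adjSpectrum {V : Type*} [Fintype V] [DecidableEq V] (G : SimpleGraph V) :
    Multiset ℝ :=
  (G.adjMatrix ℝ).charpoly.roots

/-- Two finite graphs are cospectral if their adjacency matrices have the same spectrum. -/
def Cospectral {V W : Type*} [Fintype V] [DecidableEq V] [Fintype W] [DecidableEq W]
    (G : SimpleGraph V) (H : SimpleGraph W) : Prop :=
  G.adjSpectrum = H.adjSpectrum

/-- `G` is determined by its spectrum: every finite graph cospectral with `G` is isomorphic to `G`.
Every finite graph is isomorphic to one on some `Fin k`, so it is enough to let `H` range over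
the graphs on the types `Fin k`. The number `k` of vertices is not prescribed. -/
def IsDS {V : Type*} [Fintype V] [DecidableEq V] (G : SimpleGraph V) : Prop :=
  ∀ (k : ℕ) (H : SimpleGraph (Fin k)), Cospectral G H → Nonempty (G ≃g H)

/-- `G` is obtained from the complete graph on its vertex set by removing exactly `m` edges. -/
def IsCompleteMinusEdges {V : Type*} (G : SimpleGraph V) (m : ℕ) : Prop :=
  ∃ S : Finset (Sym2 V), (S : Set (Sym2 V)) ⊆ (completeGraph V).edgeSet ∧ S.card = m ∧
    G = (completeGraph V).deleteEdges (S : Set (Sym2 V))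

/-- `G` is `K_n ∖ H`, where `n` is the number of vertices of `G`: it is obtained from the complete
graph on its vertex set by deleting the edges of a copy of the graph `H`. -/
def IsCompleteMinusGraph {V W : Type*} (G : SimpleGraph V) (H : SimpleGraph W) : Prop :=
  ∃ f : W ↪ V, G = (completeGraph V).deleteEdges (H.map f).edgeSet

/-- `{G, G'} = {K_n ∖ H, K_n ∖ H'}`. -/
def IsCompleteMinusPair {V W W' : Type*} (G G' : SimpleGraph V) (H : SimpleGraph W)
    (H' : SimpleGraph W') : Prop :=
  (G.IsCompleteMinusGraph H ∧ G'.IsCompleteMinusGraph H') ∨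
    (G.IsCompleteMinusGraph H' ∧ G'.IsCompleteMinusGraph H)

/-- The number of triangles. -/
noncomputable def triangleCount {V : Type*} (G : SimpleGraph V) : ℕ :=
  (G.cliqueSet 3).ncard

/-- The number of closed walks of length `4` (with a starting vertex and a direction). -/
noncomputable def closedFourWalkCount {V : Type*} [Fintype V] (G : SimpleGraph V) : ℕ :=
  ∑ v : V, {p : G.Walk v v | p.length = 4}.ncard

open Classical in
/-- The rank of `A + I`, where `A` is the adjacency matrix. -/
noncomputable def rankAdjAddOne {V : Type*} [Fintype V] [DecidableEq V] (G : SimpleGraph V) : ℕ :=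
  (G.adjMatrix ℝ + 1).rank

/-- The multiplicity of the eigenvalue `-1` of the adjacency matrix. -/
noncomputable def multNegOne {V : Type*} [Fintype V] [DecidableEq V] (G : SimpleGraph V) : ℕ :=
  G.adjSpectrum.count (-1)

/-- Up to isomorphism exactly `c` graphs arise from `K_n` by removing `m` edges. -/
def NumCompleteMinusEdges (n m c : ℕ) : Prop :=
  ∃ F : Fin c → SimpleGraph (Fin n), (∀ i, (F i).IsCompleteMinusEdges m) ∧
    (∀ i j, Nonempty (F i ≃g F j) → i = j) ∧
    ∀ G : SimpleGraph (Fin n), G.IsCompleteMinusEdges m → ∃ i, Nonempty (G ≃g F i)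

/-- `K_4 ∖ K_2`, that is, `K_4` with one edge deleted. -/
def k4MinusK2 : SimpleGraph (Fin 4) := (completeGraph (Fin 4)).deleteEdges {s(0, 1)}

/-- The disjoint union `K_{1,4} + K_2`. -/
def k14AddK2 : SimpleGraph ((Fin 1 ⊕ Fin 4) ⊕ Fin 2) :=
  completeBipartiteGraph (Fin 1) (Fin 4) ⊕g completeGraph (Fin 2)

/-- The path `P_6` on six vertices. -/
def p6 : SimpleGraph (Fin 6) := pathGraph 6

/-- The disjoint union `C_4 + K_2`. -/
def c4AddK2 : SimpleGraph (Fin 4 ⊕ Fin 2) := cycleGraph 4 ⊕g completeGraph (Fin 2)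

end SimpleGraph

/-! Let `B` be the adjacency matrix of the deleted graph on all `n` vertices and `J` the all-ones
matrix, so that `A = J - (I + B)`. Since `J X J = tr(J X) J`, the traces of `A ^ 3` and `A ^ 4` are
polynomials in `n` whose coefficients involve only the numbers of walks and closed walks of the
deleted graph. A spectrum fixes `n`, the number of edges, the number of triangles and the number of
closed 4-walks, so a cospectral mate also arises by deleting `m` edges and has the same two traces.

For `m ≤ 5` the deleted graph is one of finitely many (`exists_codes`). For two of them, let `a` be
the difference of the numbers of 2-walks and `b` four times that of 3-walks minus that of closed
4-walks. Equality of the traces means that `3 * a` is the difference of the numbers of closed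
3-walks and that `4 * n * a = b`. Hence either a single `n` is possible, or `a = b = 0` and all `n`
are. The finite comparison (`eq_or_exception`) leaves one pair for `n = 7` and the pair `P_6`, `C_4
+ K_2` for every `n`.

The first pair is cospectral, by an explicit intertwining matrix. The second is not: `A + I = J - B`
has rank at least 6 for `P_6` and at most 5 for `C_4 + K_2`, and its nullity is the multiplicity of
`-1`. The same comparison shows that the listed representatives are pairwise nonisomorphic, which
gives the numbers 11 and 26. -/

/-- A graph on an initial segment of `ℕ`: the number of vertices and the list of edges. -/
abbrev EdgeCode := ℕ × List (ℕ × ℕ)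

/-! ### Enumeration of the graphs with at most five edges. -/

namespace EdgeCode

/-- The code describes a simple graph, each edge being listed once, smaller vertex first. -/
abbrev Valid (c : EdgeCode) : Prop :=
  c.2.Nodup ∧ ∀ p ∈ c.2, p.1 < p.2 ∧ p.2 < c.1

/-- Representatives of the graphs with `m ≤ 5` edges and without isolated vertices. -/
def reps : ℕ → List EdgeCode
  | 0 => [(0, [])]
  | 1 => [(2, [(0, 1)])]
  | 2 => [(3, [(0, 1), (0, 2)]), (4, [(0, 1), (2, 3)])]
  | 3 =>
    [(3, [(0, 1), (0, 2), (1, 2)]),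
     (4, [(0, 1), (0, 2), (0, 3)]),
     (4, [(0, 1), (0, 2), (1, 3)]),
     (5, [(0, 1), (0, 2), (3, 4)]),
     (6, [(0, 1), (2, 3), (4, 5)])]
  | 4 =>
    [(4, [(0, 1), (0, 2), (0, 3), (1, 2)]),
     (4, [(0, 1), (0, 2), (1, 3), (2, 3)]),
     (5, [(0, 1), (0, 2), (0, 3), (0, 4)]),
     (5, [(0, 1), (0, 2), (0, 3), (1, 4)]),
     (5, [(0, 1), (0, 2), (1, 2), (3, 4)]),
     (5, [(0, 1), (0, 2), (1, 3), (2, 4)]),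
     (6, [(0, 1), (0, 2), (0, 3), (4, 5)]),
     (6, [(0, 1), (0, 2), (1, 3), (4, 5)]),
     (6, [(0, 1), (0, 2), (3, 4), (3, 5)]),
     (7, [(0, 1), (0, 2), (3, 4), (5, 6)]),
     (8, [(0, 1), (2, 3), (4, 5), (6, 7)])]
  | 5 =>
    [(4, [(0, 2), (0, 3), (1, 2), (1, 3), (2, 3)]),
     (5, [(0, 1), (0, 2), (0, 3), (0, 4), (1, 2)]),
     (5, [(0, 1), (0, 2), (0, 3), (1, 2), (1, 4)]),
     (5, [(0, 1), (0, 2), (0, 3), (1, 2), (3, 4)]),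
     (5, [(0, 1), (0, 2), (0, 3), (1, 4), (2, 4)]),
     (5, [(0, 1), (0, 2), (1, 3), (2, 4), (3, 4)]),
     (6, [(0, 1), (0, 2), (0, 3), (0, 4), (0, 5)]),
     (6, [(0, 1), (0, 2), (0, 3), (0, 4), (1, 5)]),
     (6, [(0, 1), (0, 2), (0, 3), (1, 2), (4, 5)]),
     (6, [(0, 1), (0, 2), (0, 3), (1, 4), (1, 5)]),
     (6, [(0, 1), (0, 2), (0, 3), (1, 4), (2, 5)]),
     (6, [(0, 1), (0, 2), (0, 3), (1, 4), (4, 5)]),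
     (6, [(0, 1), (0, 2), (1, 2), (3, 4), (3, 5)]),
     (6, [(0, 1), (0, 3), (1, 2), (2, 3), (4, 5)]),
     (6, [(0, 1), (1, 2), (2, 3), (3, 4), (4, 5)]),
     (7, [(0, 1), (0, 2), (0, 3), (0, 4), (5, 6)]),
     (7, [(0, 1), (0, 2), (0, 3), (1, 4), (5, 6)]),
     (7, [(0, 1), (0, 2), (0, 3), (4, 5), (4, 6)]),
     (7, [(0, 1), (0, 2), (1, 2), (3, 4), (5, 6)]),
     (7, [(0, 1), (0, 2), (1, 3), (2, 4), (5, 6)]),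
     (7, [(0, 1), (0, 2), (1, 3), (4, 5), (4, 6)]),
     (8, [(0, 1), (0, 2), (0, 3), (4, 5), (6, 7)]),
     (8, [(0, 1), (0, 2), (1, 3), (4, 5), (6, 7)]),
     (8, [(0, 1), (0, 2), (3, 4), (3, 5), (6, 7)]),
     (9, [(0, 1), (0, 2), (3, 4), (5, 6), (7, 8)]),
     (10, [(0, 1), (2, 3), (4, 5), (6, 7), (8, 9)])]
  | _ => []

/-- The code of `K_4 ∖ K_2`. -/
abbrev k4MinusK2 : EdgeCode := (4, [(0, 2), (0, 3), (1, 2), (1, 3), (2, 3)])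

/-- The code of `K_{1,4} + K_2`. -/
abbrev k14AddK2 : EdgeCode := (7, [(0, 1), (0, 2), (0, 3), (0, 4), (5, 6)])

/-- The code of `P_6`. -/
abbrev p6 : EdgeCode := (6, [(0, 1), (1, 2), (2, 3), (3, 4), (4, 5)])

/-- The code of `C_4 + K_2`. -/
abbrev c4AddK2 : EdgeCode := (6, [(0, 1), (0, 3), (1, 2), (2, 3), (4, 5)])

/-- Adjacency in the graph of a code. -/
def adj (c : EdgeCode) (a b : ℕ) : Bool := 
  c.2.any fun p => (p.1.beq a && p.2.beq b) || (p.1.beq b && p.2.beq a)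

/-- The degree of a vertex in the graph of a code. -/
def deg (c : EdgeCode) (a : ℕ) : ℕ := c.2.countP fun p => p.1.beq a || p.2.beq a

/-- The ways to add one edge, its ends being old vertices or the next new ones. -/
def extensions (c : EdgeCode) : List EdgeCode :=
  ((List.range c.1).flatMap fun b => ((List.range b).filter fun a => !c.adj a b).map
    fun a => (c.1, (a, b) :: c.2)) ++
  ((List.range c.1).map fun a => (c.1 + 1, (a, c.1) :: c.2)) ++
  [(c.1 + 2, (c.1, c.1 + 1) :: c.2)]

/-- Backtracking search for an isomorphism from `c` to `d` that extends the list `τ` of images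
by `k` further values. -/
def search (c d : EdgeCode) : ℕ → List ℕ → Option (List ℕ)
  | 0, τ => some τ
  | k + 1, τ => (List.range d.1).findSome? fun v =>
      if !τ.any (Nat.beq v) && (c.deg τ.length).beq (d.deg v) &&
        (List.range τ.length).all (fun j => c.adj j τ.length == d.adj (τ.getD j 0) v)
      then search c d k (τ ++ [v]) else none

/-- `τ` lists the images of the vertices under an isomorphism from `c` to `d`. -/
def isRelabeling (c d : EdgeCode) (τ : List ℕ) : Bool :=
  c.1.beq d.1 && (List.range c.1).all (fun a => (τ.getD a 0).blt d.1) &&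
  (List.range c.1).all (fun b => (List.range b).all fun a => !(τ.getD a 0).beq (τ.getD b 0)) &&
  c.2.all (fun p => d.adj (τ.getD p.1 0) (τ.getD p.2 0)) &&
  d.2.all (fun q => c.2.any fun p =>
    (q.1.beq (τ.getD p.1 0) && q.2.beq (τ.getD p.2 0)) ||
      (q.1.beq (τ.getD p.2 0) && q.2.beq (τ.getD p.1 0)))

/-- The sum of the products of the degrees of adjacent vertices. -/
def degSum (c : EdgeCode) : ℕ := (c.2.map fun p => c.deg p.1 * c.deg p.2).sum

/-- The search finds an isomorphism from `c` to `d`. -/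
def isoCheck (c d : EdgeCode) : Bool :=
  -- `degSum` is an isomorphism invariant that spares most searches. Soundness rests on
  -- `isRelabeling` alone, so nothing has to be proved about `degSum`, `deg` or `search`.
  c.1.beq d.1 && c.degSum.beq d.degSum && match search c d c.1 [] with
    | some τ => isRelabeling c d τ
    | none => false

/-- Every graph of `l` with an edge added is isomorphic to one of `l'`. -/
def extensionCheck (l l' : List EdgeCode) : Bool :=
  l.all fun c => c.extensions.all fun d => l'.any fun e => isoCheck e d

/-- The induction step of the classification, as a finite computation. -/
theorem extensionCheck_reps : ∀ m < 5, extensionCheck (reps m) (reps (m + 1)) = true := by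
  decide +kernel

theorem valid_of_mem_reps : ∀ m ≤ 5, ∀ c ∈ reps m, c.Valid ∧ c.2.length = m ∧ c.1 ≤ 2 * m := by
  decide +kernel

/-- The code `c` describes the edge set `S` through the labelling `f` of the vertices. -/
def Codes {V : Type*} (c : EdgeCode) (f : ℕ → V) (S : Set (Sym2 V)) : Prop :=
  Set.InjOn f (Set.Iio c.1) ∧ S = {z | ∃ p ∈ c.2, s(f p.1, f p.2) = z}

theorem adj_iff {c : EdgeCode} {a b : ℕ} :
    c.adj a b = true ↔ ∃ p ∈ c.2, (p.1 = a ∧ p.2 = b) ∨ (p.1 = b ∧ p.2 = a) := by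
  simp [adj]

/-- Composing the labelling `f` with `τ` labels the same edge set by `c`. -/
theorem Codes.exists_of_isRelabeling {V : Type*} {c d : EdgeCode} {τ : List ℕ} {f : ℕ → V}
    {S : Set (Sym2 V)} (h : isRelabeling c d τ = true) (hf : d.Codes f S) :
    ∃ g : ℕ → V, c.Codes g S := by
  simp only [isRelabeling, Bool.and_eq_true, List.all_eq_true, List.mem_range, List.any_eq_true,
    Bool.or_eq_true, Nat.beq_eq, Bool.not_eq_true', adj_iff, Nat.blt_eq] at h
  obtain ⟨⟨⟨⟨h1, h2⟩, h3⟩, h4⟩, h5⟩ := h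
  obtain ⟨hinj, rfl⟩ := hf
  refine ⟨fun a => f (τ.getD a 0), ?_, ?_⟩
  · have key : ∀ b < c.1, ∀ a < b, f (τ.getD a 0) ≠ f (τ.getD b 0) := by
      intro b hb a hab he
      have := hinj (h2 a (hab.trans hb)) (h2 b hb) he
      have h' := h3 b hb a hab
      rw [this] at h'
      simp at h'
    intro a ha b hb he
    rcases lt_trichotomy a b with hab | hab | hab
    · exact absurd he (key b hb a hab)
    · exact hab
    · exact absurd he.symm (key a ha b hab)
  · ext z
    constructor
    · rintro ⟨q, hq, rfl⟩
      obtain ⟨p, hp, ⟨e1, e2⟩ | ⟨e1, e2⟩⟩ := h5 q hq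
      · exact ⟨p, hp, by simp only [e1, e2]⟩
      · exact ⟨p, hp, by simp only [e1, e2]; exact Sym2.eq_swap⟩
    · rintro ⟨p, hp, rfl⟩
      obtain ⟨q, hq, ⟨e1, e2⟩ | ⟨e1, e2⟩⟩ := h4 p hp
      · exact ⟨q, hq, by simp only [e1, e2]⟩
      · exact ⟨q, hq, by simp only [e1, e2]; exact Sym2.eq_swap⟩

theorem Codes.exists_of_isoCheck {V : Type*} {c d : EdgeCode} {f : ℕ → V}
    {S : Set (Sym2 V)} (h : isoCheck c d = true) (hf : d.Codes f S) :
    ∃ g : ℕ → V, c.Codes g S := by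
  unfold isoCheck at h
  split at h
  · simp only [Bool.and_eq_true] at h
    exact hf.exists_of_isRelabeling h.2
  · simp at h

/-- Redefining the labelling outside the range of vertices does not matter. -/
theorem Codes.update {V : Type*} {c : EdgeCode} {f : ℕ → V} {S : Set (Sym2 V)} (hc : c.Valid)
    (hf : c.Codes f S) {v : V} (hv : ∀ a < c.1, f a ≠ v) :
    EdgeCode.Codes (c.1 + 1, c.2) (Function.update f c.1 v) S := by
  obtain ⟨hinj, rfl⟩ := hf
  have hlt : ∀ a < c.1, Function.update f c.1 v a = f a := fun a ha =>
    Function.update_of_ne ha.ne _ _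
  refine ⟨?_, ?_⟩
  · intro a ha b hb he
    simp only [Set.mem_Iio, Nat.lt_succ_iff_lt_or_eq] at ha hb
    rcases ha with ha | rfl <;> rcases hb with hb | rfl
    · rw [hlt a ha, hlt b hb] at he
      exact hinj ha hb he
    · rw [hlt a ha, Function.update_self] at he
      exact absurd he (hv a ha)
    · rw [hlt b hb, Function.update_self] at he
      exact absurd he.symm (hv b hb)
    · rfl
  · ext z
    refine exists_congr fun p => and_congr_right fun hp => ?_
    rw [hlt _ ((hc.2 p hp).1.trans (hc.2 p hp).2), hlt _ (hc.2 p hp).2]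

theorem Codes.cons {V : Type*} {c : EdgeCode} {f : ℕ → V} {S : Set (Sym2 V)}
    (hf : c.Codes f S) (a b : ℕ) :
    EdgeCode.Codes (c.1, (a, b) :: c.2) f (insert s(f a, f b) S) := by
  obtain ⟨hinj, rfl⟩ := hf
  refine ⟨hinj, ?_⟩
  ext z
  simp [eq_comm]

/-- The three families in `extensions` correspond to two, one or none of the ends `u`, `v` being
labelled already; each unlabelled end receives the next free number. -/
theorem Codes.exists_extension {V : Type*} {c : EdgeCode} {f : ℕ → V} {S : Set (Sym2 V)}
    (hc : c.Valid) (hf : c.Codes f S) {u v : V} (huv : u ≠ v) (hS : s(u, v) ∉ S) :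
    ∃ d ∈ c.extensions, ∃ g : ℕ → V, d.Codes g (insert s(u, v) S) := by
  have one : ∀ a < c.1, ∀ w, (∀ b < c.1, f b ≠ w) →
      ∃ d ∈ c.extensions, ∃ g : ℕ → V, d.Codes g (insert s(f a, w) S) := by
    intro a ha w hw
    refine ⟨(c.1 + 1, (a, c.1) :: c.2), ?_, Function.update f c.1 w, ?_⟩
    · simp only [extensions, List.mem_append, List.mem_map, List.mem_range]
      exact Or.inl (Or.inr ⟨a, ha, rfl⟩)
    · have := (hf.update hc hw).cons a c.1
      rwa [Function.update_self, Function.update_of_ne ha.ne] at this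
  by_cases hu : ∃ a < c.1, f a = u
  · obtain ⟨a, ha, rfl⟩ := hu
    by_cases hv : ∃ a < c.1, f a = v
    · obtain ⟨b, hb, rfl⟩ := hv
      have two : ∀ a b, a < b → b < c.1 → s(f a, f b) ∉ S →
          ∃ d ∈ c.extensions, ∃ g : ℕ → V, d.Codes g (insert s(f a, f b) S) := by
        intro a b hab hb hS
        refine ⟨(c.1, (a, b) :: c.2), ?_, f, hf.cons a b⟩
        simp only [extensions, List.mem_append, List.mem_map, List.mem_range, List.mem_flatMap,
          List.mem_filter]
        refine Or.inl (Or.inl ⟨b, hb, a, ⟨hab, ?_⟩, rfl⟩)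
        rw [Bool.not_eq_true', ← Bool.not_eq_true, adj_iff]
        rintro ⟨p, hp, ⟨rfl, rfl⟩ | ⟨rfl, rfl⟩⟩
        · exact hS (hf.2 ▸ ⟨p, hp, rfl⟩)
        · exact hS (hf.2 ▸ ⟨p, hp, Sym2.eq_swap⟩)
      rcases lt_trichotomy a b with hab | rfl | hab
      · exact two a b hab hb hS
      · exact absurd rfl huv
      · rw [Sym2.eq_swap] at hS ⊢
        exact two b a hab ha hS
    · push Not at hv
      exact one a ha v hv
  · push Not at hu
    by_cases hv : ∃ a < c.1, f a = v
    · obtain ⟨b, hb, rfl⟩ := hv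
      rw [Sym2.eq_swap]
      exact one b hb u hu
    · push Not at hv
      refine ⟨(c.1 + 2, (c.1, c.1 + 1) :: c.2), by simp [extensions],
        Function.update (Function.update f c.1 u) (c.1 + 1) v, ?_⟩
      have h1 := hf.update hc hu
      have h2 := (h1.update (c := (c.1 + 1, c.2)) (v := v)
        ⟨hc.1, fun p hp => ⟨(hc.2 p hp).1, (hc.2 p hp).2.trans (Nat.lt_succ_self _)⟩⟩ ?_).cons
          c.1 (c.1 + 1)
      · simpa using h2
      · intro a ha
        rcases Nat.lt_succ_iff_lt_or_eq.mp ha with ha | rfl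
        · rw [Function.update_of_ne ha.ne]
          exact hv a ha
        · rwa [Function.update_self]

/-- Completeness of `reps`, by induction on the number of edges: remove an edge, code the rest, add
the edge again and replace the resulting extension by its representative. -/
theorem exists_codes {V : Type*} [Nonempty V] [DecidableEq V] (m : ℕ) (hm : m ≤ 5)
    (S : Finset (Sym2 V)) (hS : S.card = m) (hd : ∀ z ∈ S, ¬ z.IsDiag) :
    ∃ c ∈ reps m, ∃ f : ℕ → V, c.Codes f (S : Set (Sym2 V)) := by
  induction m generalizing S with
  | zero =>
    obtain ⟨v⟩ := ‹Nonempty V›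
    rw [Finset.card_eq_zero] at hS
    subst hS
    exact ⟨(0, []), by simp [reps], fun _ => v, by simp [Codes]⟩
  | succ m ih =>
    obtain ⟨z, T, hz, rfl, hT⟩ := Finset.card_eq_succ.mp hS
    obtain ⟨c, hc, f, hf⟩ := ih (by omega) T hT fun x hx => hd x (Finset.mem_insert_of_mem hx)
    have hcv := (valid_of_mem_reps m (by omega) c hc).1
    induction z with | _ u v =>
    have huv : u ≠ v := by simpa using hd s(u, v) (Finset.mem_insert_self _ _)
    obtain ⟨d, hd', g, hg⟩ := hf.exists_extension hcv huv (by simpa using hz)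
    have hx := extensionCheck_reps m (by omega)
    simp only [extensionCheck, List.all_eq_true, List.any_eq_true] at hx
    obtain ⟨e, he, hed⟩ := hx c hc d hd'
    refine ⟨e, he, ?_⟩
    rw [Finset.coe_insert]
    exact hg.exists_of_isoCheck hed

end EdgeCode

/-! ### Complete graphs minus a coded graph. -/

namespace SimpleGraph

/-- `G` is the complete graph with the edges of a copy of the graph of the code `c` deleted. -/
def IsCompleteMinusCode {V : Type*} (G : SimpleGraph V) (c : EdgeCode) : Prop :=
  ∃ f : ℕ → V, Set.InjOn f (Set.Iio c.1) ∧
    G = (completeGraph V).deleteEdges {z | ∃ p ∈ c.2, s(f p.1, f p.2) = z}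

theorem IsCompleteMinusEdges.exists_code {V : Type*} [Nonempty V] {G : SimpleGraph V}
    {m : ℕ} (hm : m ≤ 5) (hG : G.IsCompleteMinusEdges m) :
    ∃ c ∈ EdgeCode.reps m, G.IsCompleteMinusCode c := by
  classical
  obtain ⟨S, hS, hc, rfl⟩ := hG
  obtain ⟨c, hc, f, hf, hfS⟩ := EdgeCode.exists_codes m hm S hc fun z hz =>
    not_isDiag_of_mem_edgeSet _ (hS hz)
  exact ⟨c, hc, f, hf, by rw [hfS]⟩

theorem IsCompleteMinusCode.isCompleteMinusEdges {V : Type*} {G : SimpleGraph V} {c : EdgeCode}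
    (hc : c.Valid) (hG : G.IsCompleteMinusCode c) : G.IsCompleteMinusEdges c.2.length := by
  classical
  obtain ⟨f, hf, rfl⟩ := hG
  have hlt := fun p hp => (hc.2 p hp).1.trans (hc.2 p hp).2
  refine ⟨(c.2.map fun p => s(f p.1, f p.2)).toFinset, ?_, ?_, ?_⟩
  · intro z hz
    simp only [List.coe_toFinset, List.mem_map, Set.mem_ofPred_eq] at hz
    obtain ⟨p, hp, rfl⟩ := hz
    simp only [completeGraph_eq_top, mem_edgeSet, top_adj]
    exact fun he => (hc.2 p hp).1.ne (hf (hlt p hp) (hc.2 p hp).2 he)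
  · rw [List.toFinset_card_of_nodup, List.length_map]
    refine hc.1.map_on fun p hp q hq he => ?_
    rcases Sym2.eq_iff.mp he with ⟨h1, h2⟩ | ⟨h1, h2⟩
    · exact Prod.ext (hf (hlt p hp) (hlt q hq) h1) (hf (hc.2 p hp).2 (hc.2 q hq).2 h2)
    · have h1 := hf (hlt p hp) (hc.2 q hq).2 h1
      have h2 := hf (hc.2 p hp).2 (hlt q hq) h2
      have := (hc.2 p hp).1
      have := (hc.2 q hq).1
      omega
  · congr 1
    ext z
    simp

/-- Two injective labellings of finitely many vertices differ by a permutation of `V`, which carries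
one deleted edge set to the other. -/
theorem IsCompleteMinusCode.nonempty_iso {V : Type*} {G G' : SimpleGraph V}
    {c : EdgeCode} (hc : c.Valid) (hG : G.IsCompleteMinusCode c) (hG' : G'.IsCompleteMinusCode c) :
    Nonempty (G ≃g G') := by
  obtain ⟨f, hf, rfl⟩ := hG
  obtain ⟨g, hg, rfl⟩ := hG'
  have hlt := fun p hp => (hc.2 p hp).1.trans (hc.2 p hp).2
  obtain ⟨σ, hσ⟩ := Equiv.Perm.exists_extending_pair (fun a : Fin c.1 => f a)
    (fun a : Fin c.1 => g a) (fun a b h => Fin.ext (hf a.2 b.2 h))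
    (fun a b h => Fin.ext (hg a.2 b.2 h))
  have hσ' : ∀ a < c.1, g a = σ (f a) := fun a ha => (hσ ⟨a, ha⟩).symm
  refine ⟨⟨σ, fun {x y} => ?_⟩⟩
  simp only [completeGraph_eq_top, deleteEdges_adj, top_adj, ne_eq, EmbeddingLike.apply_eq_iff_eq,
    Set.mem_ofPred_eq]
  refine and_congr_right fun _ => not_congr <| exists_congr fun p => and_congr_right fun hp => ?_
  rw [hσ' _ (hlt p hp), hσ' _ (hc.2 p hp).2]
  simp

theorem isCompleteMinusGraph_iff_code {V W : Type*} {G : SimpleGraph V} {H : SimpleGraph W}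
    {c : EdgeCode} (h0 : 0 < c.1) (e : W ≃ Fin c.1) (hc : c.Valid)
    (h : ∀ x y, H.Adj x y ↔ c.adj (e x) (e y) = true) :
    G.IsCompleteMinusGraph H ↔ G.IsCompleteMinusCode c := by
  have hlt := fun p hp => (hc.2 p hp).1.trans (hc.2 p hp).2
  have key : ∀ (φ : W ↪ V) (f : ℕ → V), (∀ x, φ x = f (e x)) →
      (H.map φ).edgeSet = {z | ∃ p ∈ c.2, s(f p.1, f p.2) = z} := by
    intro φ f hφ
    ext z
    induction z with | _ u v =>
    simp only [mem_edgeSet, map_adj, Set.mem_ofPred_eq, h, EdgeCode.adj_iff, hφ]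
    constructor
    · rintro ⟨x, y, ⟨p, hp, ⟨h1, h2⟩ | ⟨h1, h2⟩⟩, rfl, rfl⟩
      · exact ⟨p, hp, by rw [h1, h2]⟩
      · exact ⟨p, hp, by rw [h1, h2, Sym2.eq_swap]⟩
    · rintro ⟨p, hp, he⟩
      rcases Sym2.eq_iff.mp he with ⟨h1, h2⟩ | ⟨h1, h2⟩
      · exact ⟨e.symm ⟨_, hlt p hp⟩, e.symm ⟨_, (hc.2 p hp).2⟩, ⟨p, hp, by simp⟩, by simpa using h1,
          by simpa using h2⟩
      · exact ⟨e.symm ⟨_, (hc.2 p hp).2⟩, e.symm ⟨_, hlt p hp⟩, ⟨p, hp, by simp⟩, by simpa using h2,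
          by simpa using h1⟩
  constructor
  · rintro ⟨φ, rfl⟩
    -- Values at `a ≥ c.1` play no role; `h0` only provides a default.
    refine ⟨fun a => if ha : a < c.1 then φ (e.symm ⟨a, ha⟩) else φ (e.symm ⟨0, h0⟩), ?_, ?_⟩
    · intro a ha b hb hab
      simpa [show a < c.1 from ha, show b < c.1 from hb] using hab
    · rw [key φ (fun a => if ha : a < c.1 then φ (e.symm ⟨a, ha⟩) else φ (e.symm ⟨0, h0⟩))
        fun x => by simp]
  · rintro ⟨f, hf, rfl⟩
    refine ⟨⟨fun x => f (e x), fun x y hxy => ?_⟩, ?_⟩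
    · exact e.injective (Fin.ext (hf (e x).2 (e y).2 hxy))
    · rw [key _ f fun x => rfl]

end SimpleGraph

/-! ### Traces of powers of `J - C`. -/

namespace Matrix

/-- The all-ones matrix. -/
def allOnes (V : Type*) : Matrix V V ℝ := of fun _ _ => 1

variable {V : Type*} [Fintype V]

/-- `J` has rank one, so anything between two copies of it collapses to a scalar. This is what
reduces the noncommutative expansions below to traces of `J * C ^ i` and `C ^ i`. -/
theorem allOnes_mul_mul_allOnes (X : Matrix V V ℝ) :
    allOnes V * X * allOnes V = trace (allOnes V * X) • allOnes V := by
  ext i j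
  simp only [allOnes, mul_apply, of_apply, one_mul, mul_one, smul_apply, trace, diag_apply,
    smul_eq_mul]

theorem trace_allOnes : trace (allOnes V) = Fintype.card V := by
  simp [trace, allOnes]

variable [DecidableEq V]

theorem allOnes_mul_allOnes : allOnes V * allOnes V = (Fintype.card V : ℝ) • allOnes V := by
  simpa [trace_allOnes] using allOnes_mul_mul_allOnes (1 : Matrix V V ℝ)

theorem trace_allOnes_sub_pow_three (C : Matrix V V ℝ) :
    trace ((allOnes V - C) ^ 3) = (Fintype.card V : ℝ) ^ 3 -
      3 * Fintype.card V * trace (allOnes V * C) + 3 * trace (allOnes V * C ^ 2) -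
      trace (C ^ 3) := by
  set J := allOnes V with hJ
  have e : (J - C) ^ 3 = J * J * J - (J * J * C + J * C * J + C * (J * J)) +
      (J * (C * C) + C * J * C + C * C * J) - C ^ 3 := by noncomm_ring
  rw [e]
  have c1 : trace (C * J * C) = trace (J * (C * C)) := by
    rw [mul_assoc, trace_mul_comm, mul_assoc]
  have c2 : trace (C * C * J) = trace (J * (C * C)) := trace_mul_comm _ _
  have c3 : trace (C * J) = trace (J * C) := trace_mul_comm _ _
  have c4 : J * J = (Fintype.card V : ℝ) • J := allOnes_mul_allOnes
  have c5 : J * C * J = trace (J * C) • J := allOnes_mul_mul_allOnes C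
  have c6 : trace J = Fintype.card V := trace_allOnes
  simp only [trace_add, trace_sub, c1, c2, c3, c4, c5, c6, smul_mul, Matrix.mul_smul, trace_smul,
    smul_eq_mul, pow_two]
  ring

theorem trace_allOnes_sub_pow_four (C : Matrix V V ℝ) :
    trace ((allOnes V - C) ^ 4) = (Fintype.card V : ℝ) ^ 4 -
      4 * (Fintype.card V : ℝ) ^ 2 * trace (allOnes V * C) +
      4 * Fintype.card V * trace (allOnes V * C ^ 2) + 2 * trace (allOnes V * C) ^ 2 -
      4 * trace (allOnes V * C ^ 3) + trace (C ^ 4) := by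
  set J := allOnes V with hJ
  have hJJ : J * J = (Fintype.card V : ℝ) • J := allOnes_mul_allOnes
  have hJXJ : ∀ X, J * (X * J) = trace (J * X) • J := fun X => by
    rw [← mul_assoc]; exact allOnes_mul_mul_allOnes X
  have e2 : (J - C) ^ 2 = (Fintype.card V : ℝ) • J - J * C - C * J + C ^ 2 := by
    rw [← hJJ]; noncomm_ring
  have e : (J - C) ^ 4 = (J - C) ^ 2 * (J - C) ^ 2 := by noncomm_ring
  have c1 : trace (C * J * C ^ 2) = trace (J * C ^ 3) := by
    rw [mul_assoc, trace_mul_comm, mul_assoc, ← pow_succ]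
  have c2 : trace (C ^ 2 * (C * J)) = trace (J * C ^ 3) := by
    rw [← mul_assoc, trace_mul_comm, ← pow_succ]
  have c3 : trace (C * J * (J * C)) = Fintype.card V * trace (J * C ^ 2) := by
    rw [mul_assoc, ← mul_assoc J, hJJ, smul_mul, Matrix.mul_smul, trace_smul, trace_mul_comm,
      mul_assoc, ← pow_two, smul_eq_mul]
  have c4 : trace (J * C * (C * J)) = Fintype.card V * trace (J * C ^ 2) := by
    rw [mul_assoc, ← mul_assoc C, ← pow_two, hJXJ, trace_smul, hJ, trace_allOnes, smul_eq_mul,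
      mul_comm]
  have c5 : trace (J * C * (J * C)) = trace (J * C) ^ 2 := by
    rw [← mul_assoc, allOnes_mul_mul_allOnes, smul_mul, trace_smul, smul_eq_mul, pow_two]
  have c6 : trace (C * J * (C * J)) = trace (J * C) ^ 2 := by
    rw [mul_assoc, hJXJ, Matrix.mul_smul, trace_smul, trace_mul_comm C, smul_eq_mul, pow_two]
  have c7 : trace (J * C * C ^ 2) = trace (J * C ^ 3) := by
    rw [mul_assoc, ← pow_succ']
  have c8 : trace (C ^ 2 * (J * C)) = trace (J * C ^ 3) := by
    rw [trace_mul_comm, c7]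
  have c10 : trace (C ^ 2 * J) = trace (J * C ^ 2) := trace_mul_comm _ _
  have c11 : trace (J * (J * C)) = Fintype.card V * trace (J * C) := by
    rw [← mul_assoc, hJJ, smul_mul, trace_smul, smul_eq_mul]
  have c12 : trace (J * (C * J)) = Fintype.card V * trace (J * C) := by
    rw [hJXJ, trace_smul, hJ, trace_allOnes, smul_eq_mul, mul_comm]
  have c13 : trace (J * C * J) = Fintype.card V * trace (J * C) := by
    rw [mul_assoc, c12]
  have c14 : trace (C * J * J) = Fintype.card V * trace (J * C) := by
    rw [trace_mul_comm, c12]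
  have c15 : trace J = Fintype.card V := trace_allOnes
  have c16 : C ^ 2 * C ^ 2 = C ^ 4 := by rw [← pow_add]
  rw [e, e2]
  simp only [add_mul, sub_mul, mul_add, mul_sub, trace_add, trace_sub, smul_mul, Matrix.mul_smul,
    trace_smul, smul_eq_mul, hJJ, c1, c2, c3, c4, c5, c6, c7, c8, c10, c11, c12, c13, c14, c15,
    c16]
  ring

end Matrix

/-! ### Walk counts of a code and the resulting trace formulas. -/

namespace EdgeCode

/-- Compose two lists of walks, given by their ends. -/
def compose (l l' : List (ℕ × ℕ)) : List (ℕ × ℕ) :=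
  l.flatMap fun p => (l'.filter fun q => q.1.beq p.2).map fun q => (p.1, q.2)

/-- The edges of a code in both directions. -/
def darts (c : EdgeCode) : List (ℕ × ℕ) := c.2 ++ c.2.map Prod.swap

/-- The ends of the walks with `k + 1` edges. -/
def walks (c : EdgeCode) : ℕ → List (ℕ × ℕ)
  | 0 => c.darts
  | k + 1 => compose (c.walks k) c.darts

/-- The number of closed walks in a list. -/
def closed (l : List (ℕ × ℕ)) : ℕ := l.countP fun p => p.1.beq p.2

theorem nodup_darts {c : EdgeCode} (hc : c.Valid) : c.darts.Nodup := by
  refine List.Nodup.append hc.1 (hc.1.map Prod.swap_injective) fun p hp hp' => ?_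
  obtain ⟨q, hq, rfl⟩ := List.mem_map.mp hp'
  exact absurd (hc.2 _ hp).1 (hc.2 _ hq).1.not_gt

theorem lt_of_mem_darts {c : EdgeCode} (hc : c.Valid) {p : ℕ × ℕ} (hp : p ∈ c.darts) :
    p.1 < c.1 ∧ p.2 < c.1 := by
  rcases List.mem_append.mp hp with h | h
  · exact ⟨(hc.2 p h).1.trans (hc.2 p h).2, (hc.2 p h).2⟩
  · obtain ⟨q, hq, rfl⟩ := List.mem_map.mp h
    exact ⟨(hc.2 q hq).2, (hc.2 q hq).1.trans (hc.2 q hq).2⟩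

theorem lt_of_mem_walks {c : EdgeCode} (hc : c.Valid) (k : ℕ) {p : ℕ × ℕ} (hp : p ∈ c.walks k) :
    p.1 < c.1 ∧ p.2 < c.1 := by
  induction k generalizing p with
  | zero => exact lt_of_mem_darts hc hp
  | succ k ih =>
    simp only [walks, compose, List.mem_flatMap, List.mem_map, List.mem_filter] at hp
    obtain ⟨q, hq, r, ⟨hr, -⟩, rfl⟩ := hp
    exact ⟨(ih hq).1, (lt_of_mem_darts hc hr).2⟩

variable {V : Type*} [DecidableEq V]

/-- The matrix that counts the walks of a list. -/
def listMatrix (f : ℕ → V) (l : List (ℕ × ℕ)) : Matrix V V ℝ :=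
  (l.map fun p => Matrix.single (f p.1) (f p.2) 1).sum

@[simp] theorem listMatrix_nil (f : ℕ → V) : listMatrix f [] = 0 := rfl

@[simp] theorem listMatrix_cons (f : ℕ → V) (p : ℕ × ℕ) (l : List (ℕ × ℕ)) :
    listMatrix f (p :: l) = Matrix.single (f p.1) (f p.2) 1 + listMatrix f l := by
  simp [listMatrix]

theorem listMatrix_append (f : ℕ → V) (l l' : List (ℕ × ℕ)) :
    listMatrix f (l ++ l') = listMatrix f l + listMatrix f l' := by
  simp [listMatrix]

theorem listMatrix_apply_eq_zero (f : ℕ → V) {l : List (ℕ × ℕ)} {x y : V}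
    (h : ¬ ∃ p ∈ l, f p.1 = x ∧ f p.2 = y) : listMatrix f l x y = 0 := by
  induction l with
  | nil => simp
  | cons p l ih =>
    have hp : ¬ (f p.1 = x ∧ f p.2 = y) := fun hp => h ⟨p, List.mem_cons_self, hp⟩
    rw [listMatrix_cons, Matrix.add_apply, Matrix.single_apply, if_neg hp,
      ih fun ⟨q, hq, h'⟩ => h ⟨q, List.mem_cons_of_mem _ hq, h'⟩, add_zero]

/-- As `f` is injective on the labels and the list has no repetitions, exactly one matrix unit
contributes to the entry. -/
theorem listMatrix_apply_eq_one {f : ℕ → V} {s : ℕ} (hf : Set.InjOn f (Set.Iio s))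
    {l : List (ℕ × ℕ)} (hl : ∀ p ∈ l, p.1 < s ∧ p.2 < s) (hn : l.Nodup) {x y : V}
    (h : ∃ p ∈ l, f p.1 = x ∧ f p.2 = y) : listMatrix f l x y = 1 := by
  induction l with
  | nil => simp at h
  | cons p l ih =>
    rw [listMatrix_cons, Matrix.add_apply, Matrix.single_apply]
    obtain ⟨hpl, hn⟩ := List.nodup_cons.mp hn
    have hp := hl p List.mem_cons_self
    by_cases h' : f p.1 = x ∧ f p.2 = y
    · rw [if_pos h', listMatrix_apply_eq_zero, add_zero]
      rintro ⟨q, hq, h1, h2⟩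
      have hq' := hl q (List.mem_cons_of_mem _ hq)
      have : q = p := Prod.ext (hf hq'.1 hp.1 (h1.trans h'.1.symm))
        (hf hq'.2 hp.2 (h2.trans h'.2.symm))
      exact hpl (this ▸ hq)
    · rw [if_neg h', zero_add]
      refine ih (fun p hp => hl p (List.mem_cons_of_mem _ hp)) hn ?_
      obtain ⟨q, hq, h2⟩ := h
      rcases List.mem_cons.mp hq with rfl | hq
      · exact absurd h2 h'
      · exact ⟨q, hq, h2⟩

variable [Fintype V]

/-- A product of two matrix units is nonzero only if the inner indices agree, and by injectivity
this can be tested on the labels. -/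
theorem listMatrix_mul {f : ℕ → V} {s : ℕ} (hf : Set.InjOn f (Set.Iio s)) {l l' : List (ℕ × ℕ)}
    (hl : ∀ p ∈ l, p.2 < s) (hl' : ∀ q ∈ l', q.1 < s) :
    listMatrix f l * listMatrix f l' = listMatrix f (compose l l') := by
  induction l with
  | nil => simp [compose]
  | cons p l ih =>
    have h1 : Matrix.single (f p.1) (f p.2) 1 * listMatrix f l' =
        listMatrix f ((l'.filter fun q => q.1.beq p.2).map fun q => (p.1, q.2)) := by
      have hp := hl p List.mem_cons_self
      clear ih hl
      induction l' with
      | nil => simp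
      | cons q l' ih =>
        have ih := ih fun q hq => hl' q (List.mem_cons_of_mem _ hq)
        rw [listMatrix_cons, mul_add, ih, List.filter_cons]
        by_cases hq : q.1 = p.2
        · simp [hq]
        · have : f p.2 ≠ f q.1 := fun he => hq (hf hp (hl' q List.mem_cons_self) he).symm
          simp [hq, this]
    rw [listMatrix_cons, add_mul, ih fun p hp => hl p (List.mem_cons_of_mem _ hp), h1]
    rw [← listMatrix_append]
    rfl

theorem trace_listMatrix {f : ℕ → V} {s : ℕ} (hf : Set.InjOn f (Set.Iio s)) {l : List (ℕ × ℕ)}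
    (hl : ∀ p ∈ l, p.1 < s ∧ p.2 < s) : (listMatrix f l).trace = closed l := by
  induction l with
  | nil => simp [closed]
  | cons p l ih =>
    rw [listMatrix_cons, Matrix.trace_add, ih fun p hp => hl p (List.mem_cons_of_mem _ hp)]
    have hp := hl p List.mem_cons_self
    by_cases h : p.1 = p.2
    · simp [closed, h, add_comm]
    · have : f p.1 ≠ f p.2 := fun he => h (hf hp.1 hp.2 he)
      simp [closed, h, this]

/-- The trace of `J * X` is the sum of the entries of `X`, so `J` counts all walks where the plain
trace counts the closed ones. -/
theorem trace_allOnes_mul_listMatrix (f : ℕ → V) (l : List (ℕ × ℕ)) :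
    (Matrix.allOnes V * listMatrix f l).trace = l.length := by
  induction l with
  | nil => simp
  | cons p l ih =>
    rw [listMatrix_cons, mul_add, Matrix.trace_add, ih, Matrix.trace_mul_single]
    simp [Matrix.allOnes, add_comm]

theorem listMatrix_darts_pow {c : EdgeCode} (hc : c.Valid) {f : ℕ → V}
    (hf : Set.InjOn f (Set.Iio c.1)) (k : ℕ) :
    listMatrix f c.darts ^ (k + 1) = listMatrix f (c.walks k) := by
  induction k with
  | zero => simp [walks]
  | succ k ih =>
    rw [pow_succ, ih, listMatrix_mul hf (fun p hp => (lt_of_mem_walks hc k hp).2)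
      (fun p hp => (lt_of_mem_darts hc hp).1)]
    rfl

/-- The trace of the third power of the adjacency matrix of `K_n` minus the graph of a code. -/
def traceThree (n : ℤ) (c : EdgeCode) : ℤ :=
  n ^ 3 - 3 * n * (n + (c.walks 0).length) +
    3 * (n + 2 * (c.walks 0).length + (c.walks 1).length) -
    (n + 3 * closed (c.walks 0) + 3 * closed (c.walks 1) + closed (c.walks 2))

/-- The trace of the fourth power of the adjacency matrix of `K_n` minus the graph of a code. -/
def traceFour (n : ℤ) (c : EdgeCode) : ℤ :=
  n ^ 4 - 4 * n ^ 2 * (n + (c.walks 0).length) +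
    4 * n * (n + 2 * (c.walks 0).length + (c.walks 1).length) +
    2 * (n + (c.walks 0).length) ^ 2 -
    4 * (n + 3 * (c.walks 0).length + 3 * (c.walks 1).length + (c.walks 2).length) +
    (n + 4 * closed (c.walks 0) + 6 * closed (c.walks 1) + 4 * closed (c.walks 2) +
      closed (c.walks 3))

end EdgeCode

namespace SimpleGraph

open Matrix EdgeCode

variable {V : Type*} [DecidableEq V] {G : SimpleGraph V} [DecidableRel G.Adj] {c : EdgeCode}

/-- The identity `A = J - (I + B)`, with `B` written as a sum of matrix units over the darts. -/
theorem IsCompleteMinusCode.exists_adjMatrix_eq (hc : c.Valid) (hG : G.IsCompleteMinusCode c) :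
    ∃ f : ℕ → V, Set.InjOn f (Set.Iio c.1) ∧
      G.adjMatrix ℝ = allOnes V - (1 + listMatrix f c.darts) := by
  classical
  obtain ⟨f, hf, h⟩ := hG
  refine ⟨f, hf, ?_⟩
  ext x y
  rw [Matrix.sub_apply, Matrix.add_apply, adjMatrix_apply, Matrix.one_apply]
  have hxy : G.Adj x y ↔ x ≠ y ∧ ¬ ∃ p ∈ c.darts, f p.1 = x ∧ f p.2 = y := by
    simp only [h, completeGraph_eq_top, deleteEdges_adj, top_adj, Set.mem_ofPred_eq]
    refine and_congr_right fun _ => not_congr ?_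
    simp only [Sym2.eq_iff, darts, List.mem_append, List.mem_map, or_and_right, exists_or]
    constructor
    · rintro ⟨p, hp, h | h⟩
      · exact Or.inl ⟨p, hp, h⟩
      · exact Or.inr ⟨_, ⟨p, hp, rfl⟩, h.symm⟩
    · rintro (⟨p, hp, h⟩ | ⟨_, ⟨p, hp, rfl⟩, h⟩)
      · exact ⟨p, hp, Or.inl h⟩
      · exact ⟨p, hp, Or.inr h.symm⟩
  rw [if_congr hxy rfl rfl]
  by_cases he : x = y
  · have : ¬ ∃ p ∈ c.darts, f p.1 = x ∧ f p.2 = y := by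
      rintro ⟨p, hp, h1, h2⟩
      have hlt := lt_of_mem_darts hc hp
      have h3 := hf hlt.1 hlt.2 (by rw [h1, h2, he])
      rcases List.mem_append.mp hp with h | h
      · exact (hc.2 p h).1.ne h3
      · obtain ⟨q, hq, rfl⟩ := List.mem_map.mp h
        exact (hc.2 q hq).1.ne' h3
    rw [listMatrix_apply_eq_zero f this, if_neg fun h => h.1 he, if_pos he]
    simp [allOnes]
  · by_cases h' : ∃ p ∈ c.darts, f p.1 = x ∧ f p.2 = y
    · rw [listMatrix_apply_eq_one hf (fun p => lt_of_mem_darts hc) (nodup_darts hc) h',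
        if_neg fun h => h.2 h', if_neg he]
      simp [allOnes]
    · rw [listMatrix_apply_eq_zero f h', if_pos ⟨he, h'⟩, if_neg he]
      simp [allOnes]

variable [Fintype V]

theorem IsCompleteMinusCode.trace_pow_three (hc : c.Valid) (hG : G.IsCompleteMinusCode c) :
    (G.adjMatrix ℝ ^ 3).trace = traceThree (Fintype.card V) c := by
  obtain ⟨f, hf, hA⟩ := hG.exists_adjMatrix_eq hc
  set B := listMatrix f c.darts with hB
  have t := fun k => trace_listMatrix hf fun p => lt_of_mem_walks hc k
  have hp := listMatrix_darts_pow hc hf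
  have e1 : B = listMatrix f (c.walks 0) := rfl
  have e2 : (1 + B) ^ 2 = 1 + (2 : ℝ) • B + B ^ 2 := by
    rw [two_smul]; noncomm_ring
  have e3 : (1 + B) ^ 3 = 1 + (3 : ℝ) • B + (3 : ℝ) • B ^ 2 + B ^ 3 := by
    rw [show (3 : ℝ) = ((3 : ℕ) : ℝ) by norm_num]; simp only [Nat.cast_smul_eq_nsmul]; noncomm_ring
  rw [hA, trace_allOnes_sub_pow_three, e2, e3, hB, hp 1, hp 2, ← hB, e1]
  simp only [mul_add, trace_add, trace_smul, Matrix.mul_smul, t, trace_allOnes_mul_listMatrix,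
    mul_one, trace_allOnes, trace_one, smul_eq_mul, traceThree]
  push_cast
  ring

theorem IsCompleteMinusCode.trace_pow_four (hc : c.Valid) (hG : G.IsCompleteMinusCode c) :
    (G.adjMatrix ℝ ^ 4).trace = traceFour (Fintype.card V) c := by
  obtain ⟨f, hf, hA⟩ := hG.exists_adjMatrix_eq hc
  set B := listMatrix f c.darts with hB
  have t := fun k => trace_listMatrix hf fun p => lt_of_mem_walks hc k
  have hp := listMatrix_darts_pow hc hf
  have e1 : B = listMatrix f (c.walks 0) := rfl
  have e2 : (1 + B) ^ 2 = 1 + (2 : ℝ) • B + B ^ 2 := by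
    rw [two_smul]; noncomm_ring
  have e3 : (1 + B) ^ 3 = 1 + (3 : ℝ) • B + (3 : ℝ) • B ^ 2 + B ^ 3 := by
    rw [show (3 : ℝ) = ((3 : ℕ) : ℝ) by norm_num]; simp only [Nat.cast_smul_eq_nsmul]; noncomm_ring
  have e4 : (1 + B) ^ 4 = 1 + (4 : ℝ) • B + (6 : ℝ) • B ^ 2 + (4 : ℝ) • B ^ 3 + B ^ 4 := by
    rw [show (4 : ℝ) = ((4 : ℕ) : ℝ) by norm_num, show (6 : ℝ) = ((6 : ℕ) : ℝ) by norm_num]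
    simp only [Nat.cast_smul_eq_nsmul]; noncomm_ring
  rw [hA, trace_allOnes_sub_pow_four, e2, e3, e4, hB, hp 1, hp 2, hp 3, ← hB, e1]
  simp only [mul_add, trace_add, trace_smul, Matrix.mul_smul, t, trace_allOnes_mul_listMatrix,
    mul_one, trace_allOnes, trace_one, smul_eq_mul, traceFour]
  push_cast
  ring

end SimpleGraph

/-! ### What the spectrum determines. -/

namespace SimpleGraph

variable {V W : Type*} [Fintype V] [DecidableEq V] [Fintype W] [DecidableEq W]

theorem adjSpectrum_eq_roots (G : SimpleGraph V) [DecidableRel G.Adj] :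
    G.adjSpectrum = (G.adjMatrix ℝ).charpoly.roots := by
  unfold adjSpectrum
  congr!

theorem adjSpectrum_eq_map_eigenvalues (G : SimpleGraph V) [DecidableRel G.Adj] :
    G.adjSpectrum = Finset.univ.val.map (G.isHermitian_adjMatrix ℝ).eigenvalues := by
  rw [adjSpectrum_eq_roots, (G.isHermitian_adjMatrix ℝ).roots_charpoly_eq_eigenvalues]
  rfl

theorem card_adjSpectrum (G : SimpleGraph V) : G.adjSpectrum.card = Fintype.card V := by
  classical
  rw [adjSpectrum_eq_map_eigenvalues]
  simp

theorem trace_adjMatrix_pow (G : SimpleGraph V) [DecidableRel G.Adj] (k : ℕ) :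
    (G.adjMatrix ℝ ^ k).trace = (G.adjSpectrum.map (· ^ k)).sum := by
  have hA := G.isHermitian_adjMatrix ℝ
  rw [adjSpectrum_eq_map_eigenvalues]
  conv_lhs => rw [hA.spectral_theorem, ← map_pow, Unitary.conjStarAlgAut_apply,
    Matrix.trace_mul_comm, ← mul_assoc]
  simp [Matrix.diagonal_pow, Matrix.trace_diagonal]

theorem Cospectral.trace_pow_eq {G : SimpleGraph V} {H : SimpleGraph W} [DecidableRel G.Adj]
    [DecidableRel H.Adj] (h : Cospectral G H) (k : ℕ) :
    (G.adjMatrix ℝ ^ k).trace = (H.adjMatrix ℝ ^ k).trace := by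
  rw [trace_adjMatrix_pow, trace_adjMatrix_pow, h]

theorem Cospectral.card_eq {G : SimpleGraph V} {H : SimpleGraph W} (h : Cospectral G H) :
    Fintype.card V = Fintype.card W := by
  rw [← card_adjSpectrum G, h, card_adjSpectrum]

theorem Cospectral.multNegOne_eq {G : SimpleGraph V} {H : SimpleGraph W} (h : Cospectral G H) :
    G.multNegOne = H.multNegOne := by
  rw [multNegOne, h, multNegOne]

theorem Iso.cospectral {G : SimpleGraph V} {H : SimpleGraph W} (e : G ≃g H) : Cospectral G H := by
  classical
  rw [Cospectral, adjSpectrum_eq_roots, adjSpectrum_eq_roots, ← e.reindex_adjMatrix ℝ,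
    Matrix.charpoly_reindex]

/-- The shift by one moves the root `-1` of the characteristic polynomial to `0`, and the rank of a
symmetric matrix is the number of its nonzero eigenvalues. -/
theorem multNegOne_add_rankAdjAddOne (G : SimpleGraph V) :
    G.multNegOne + G.rankAdjAddOne = Fintype.card V := by
  classical
  have hA := G.isHermitian_adjMatrix ℝ
  have hB : (G.adjMatrix ℝ + 1).IsHermitian := hA.add Matrix.isHermitian_one
  have h0 : (G.adjMatrix ℝ + 1).charpoly =
      (G.adjMatrix ℝ).charpoly.comp (Polynomial.X + Polynomial.C (-1)) := by
    rw [← Matrix.charpoly_sub_scalar]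
    congr 1
    ext i j
    by_cases h : i = j <;> simp [h]
  have h1 : G.adjSpectrum.count (-1) = (G.adjMatrix ℝ + 1).charpoly.roots.count 0 := by
    rw [adjSpectrum_eq_roots, Polynomial.count_roots, Polynomial.count_roots, h0,
      Polynomial.rootMultiplicity_eq_rootMultiplicity]
  have h2 : G.rankAdjAddOne = (G.adjMatrix ℝ + 1).rank := by
    unfold rankAdjAddOne
    congr!
  rw [multNegOne, h1, h2, hB.rank_eq_card_non_zero_eigs, hB.roots_charpoly_eq_eigenvalues,
    Multiset.count_map, Fintype.card_subtype, ← Finset.card_univ,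
    ← Finset.card_filter_add_card_filter_not (s := Finset.univ) (fun i => hB.eigenvalues i = 0)]
  congr 1
  rw [Finset.card_def, Finset.filter_val]
  simp [eq_comm]

theorem closedFourWalkCount_eq_trace (G : SimpleGraph V) [DecidableRel G.Adj] :
    (G.closedFourWalkCount : ℝ) = (G.adjMatrix ℝ ^ 4).trace := by
  rw [closedFourWalkCount, Nat.cast_sum, Matrix.trace]
  refine Finset.sum_congr rfl fun v _ => ?_
  rw [Matrix.diag_apply, adjMatrix_pow_apply_eq_card_walk, ← Nat.card_coe_set_eq,
    Nat.card_eq_fintype_card]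

/-- The trace counts ordered triples of pairwise adjacent vertices; each triangle has six orderings.
-/
theorem six_mul_triangleCount_eq_trace (G : SimpleGraph V) [DecidableRel G.Adj] :
    (6 * G.triangleCount : ℝ) = (G.adjMatrix ℝ ^ 3).trace := by
  set T : Finset (V × V × V) := Finset.univ.filter fun t =>
    G.Adj t.1 t.2.1 ∧ G.Adj t.2.1 t.2.2 ∧ G.Adj t.2.2 t.1 with hT
  have h1 : (G.adjMatrix ℝ ^ 3).trace = T.card := by
    rw [hT, Finset.card_filter, Nat.cast_sum, Fintype.sum_prod_type, pow_succ, pow_two,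
      Matrix.trace]
    refine Finset.sum_congr rfl fun a _ => ?_
    rw [Fintype.sum_prod_type_right, Matrix.diag_apply, Matrix.mul_apply]
    refine Finset.sum_congr rfl fun c _ => ?_
    rw [Matrix.mul_apply, Finset.sum_mul]
    refine Finset.sum_congr rfl fun b _ => ?_
    simp only [adjMatrix_apply]
    split_ifs <;> simp_all
  have h2 : T.card = ∑ s ∈ G.cliqueFinset 3, 6 := by
    rw [Finset.card_eq_sum_card_fiberwise (f := fun t => ({t.1, t.2.1, t.2.2} : Finset V))
      (t := G.cliqueFinset 3)]
    · refine Finset.sum_congr rfl fun s hs => ?_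
      rw [mem_cliqueFinset_iff, is3Clique_iff] at hs
      obtain ⟨a, b, c, hab, hac, hbc, rfl⟩ := hs
      have e : (T.filter fun t => ({t.1, t.2.1, t.2.2} : Finset V) = {a, b, c}) =
          {(a, b, c), (a, c, b), (b, a, c), (b, c, a), (c, a, b), (c, b, a)} := by
        ext ⟨x, y, z⟩
        simp only [hT, Finset.mem_filter, Finset.mem_univ, true_and, Finset.mem_insert,
          Finset.mem_singleton, Prod.mk.injEq]
        constructor
        · rintro ⟨⟨hxy, hyz, hzx⟩, he⟩
          have hx : x ∈ ({a, b, c} : Finset V) := he ▸ by simp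
          have hy : y ∈ ({a, b, c} : Finset V) := he ▸ by simp
          have hz : z ∈ ({a, b, c} : Finset V) := he ▸ by simp
          simp only [Finset.mem_insert, Finset.mem_singleton] at hx hy hz
          have := hxy.ne
          have := hyz.ne
          have := hzx.ne
          grind
        · rintro (⟨rfl, rfl, rfl⟩ | ⟨rfl, rfl, rfl⟩ | ⟨rfl, rfl, rfl⟩ | ⟨rfl, rfl, rfl⟩ |
            ⟨rfl, rfl, rfl⟩ | ⟨rfl, rfl, rfl⟩) <;>
          refine ⟨⟨by first | assumption | exact G.adj_symm ‹_›,
            by first | assumption | exact G.adj_symm ‹_›,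
            by first | assumption | exact G.adj_symm ‹_›⟩, ?_⟩ <;>
          ext w <;> simp only [Finset.mem_insert, Finset.mem_singleton] <;> tauto
      rw [e]
      have := hab.ne
      have := hac.ne
      have := hbc.ne
      simp [*, Ne.symm]
    · rintro ⟨a, b, c⟩ ht
      simp only [hT, Finset.coe_filter, Finset.mem_univ, true_and, Set.mem_ofPred_eq] at ht
      simp only [SetLike.mem_coe, mem_cliqueFinset_iff, is3Clique_triple_iff]
      exact ⟨ht.1, G.adj_symm ht.2.2, ht.2.1⟩
  rw [h1, h2, triangleCount, ← coe_cliqueFinset, Set.ncard_coe_finset, Finset.sum_const]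
  push_cast [smul_eq_mul]
  ring

end SimpleGraph

/-! ### The rank of `A + I`. -/

namespace EdgeCode

/-- The entries of `A + I` in terms of the code of the deleted graph. -/
def coadj (c : EdgeCode) (a b : ℕ) : ℤ := if c.adj a b then 0 else 1

theorem adj_comm (c : EdgeCode) (a b : ℕ) : c.adj a b = c.adj b a := by
  simp only [adj, Bool.or_comm]

/-- The graph `K_n` minus the graph of a code, on the first vertices. -/
def toGraph (n : ℕ) (c : EdgeCode) : SimpleGraph (Fin n) where
  Adj x y := x ≠ y ∧ c.adj x y = false
  symm := ⟨fun x y h => ⟨h.1.symm, by rw [adj_comm, h.2]⟩⟩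
  loopless := ⟨fun _ h => h.1 rfl⟩

instance (n : ℕ) (c : EdgeCode) : DecidableRel (c.toGraph n).Adj := fun x y =>
  inferInstanceAs (Decidable (x ≠ y ∧ c.adj x y = false))

theorem isCompleteMinusCode_toGraph {n : ℕ} (hn : 0 < n) {c : EdgeCode} (hc : c.Valid)
    (hcn : c.1 ≤ n) : (c.toGraph n).IsCompleteMinusCode c := by
  refine ⟨fun a => if h : a < n then ⟨a, h⟩ else ⟨0, hn⟩, fun a ha b hb h => ?_, ?_⟩
  · simpa [lt_of_lt_of_le ha hcn, lt_of_lt_of_le hb hcn] using h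
  · ext x y
    simp only [SimpleGraph.completeGraph_eq_top, SimpleGraph.deleteEdges_adj, SimpleGraph.top_adj,
      Set.mem_ofPred_eq]
    change x ≠ y ∧ c.adj x y = false ↔ _
    rw [← Bool.not_eq_true, adj_iff]
    refine and_congr_right fun _ => not_congr <| exists_congr fun p => and_congr_right fun hp => ?_
    have h2 := (hc.2 p hp).2.trans_le hcn
    have h1 := (hc.2 p hp).1.trans h2
    simp [h1, h2, Fin.ext_iff]

end EdgeCode

namespace SimpleGraph

open EdgeCode

variable {V : Type*} [Fintype V] {G : SimpleGraph V} {c : EdgeCode}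

theorem IsCompleteMinusCode.card_le (hG : G.IsCompleteMinusCode c) : c.1 ≤ Fintype.card V := by
  obtain ⟨f, hf, -⟩ := hG
  simpa using Fintype.card_le_of_injective (fun a : Fin c.1 => f a)
    fun a b h => Fin.ext (hf a.2 b.2 h)

/-- Numbering the vertices so that all those of degree `n - 1` get the same number. -/
theorem IsCompleteMinusCode.exists_index (hc : c.Valid) (hG : G.IsCompleteMinusCode c) :
    ∃ g : V → ℕ, (∀ x, g x ≤ c.1) ∧ (∀ a < c.1, ∃ x, g x = a) ∧
      (c.1 < Fintype.card V → ∃ x, g x = c.1) ∧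
      ∀ x y, G.Adj x y ↔ x ≠ y ∧ c.adj (g x) (g y) = false := by
  classical
  obtain ⟨f, hf, rfl⟩ := hG
  -- A vertex in the image of `f` gets its label, any other vertex gets `c.1`, which lies on no edge
  -- of the code.
  have hex : ∀ x, ∃ a ≤ c.1, (a < c.1 → f a = x) ∧ ∀ b < c.1, f b = x → b = a := by
    intro x
    by_cases h : ∃ a < c.1, f a = x
    · obtain ⟨a, ha, hx⟩ := h
      exact ⟨a, ha.le, fun _ => hx, fun b hb hbx => hf hb ha (hbx.trans hx.symm)⟩
    · push Not at h
      exact ⟨c.1, le_rfl, fun h => absurd h (lt_irrefl _), fun b hb hbx => absurd hbx (h b hb)⟩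
  choose g hg1 hg2 hg3 using hex
  refine ⟨g, hg1, fun a ha => ⟨f a, (hg3 _ a ha rfl).symm⟩, fun hlt => ?_, fun x y => ?_⟩
  · by_contra! hne
    refine hlt.not_ge ?_
    simpa using Fintype.card_le_of_surjective (fun a : Fin c.1 => f a) fun x =>
      ⟨⟨g x, lt_of_le_of_ne (hg1 x) (hne x)⟩, hg2 x (lt_of_le_of_ne (hg1 x) (hne x))⟩
  · simp only [completeGraph_eq_top, deleteEdges_adj, top_adj, Set.mem_ofPred_eq]
    rw [← Bool.not_eq_true, adj_iff]
    refine and_congr_right fun _ => not_congr <| exists_congr fun p => and_congr_right fun hp => ?_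
    have h2 := (hc.2 p hp).2
    have h1 := (hc.2 p hp).1.trans h2
    have key : ∀ a < c.1, ∀ x, f a = x ↔ a = g x := fun a ha x =>
      ⟨hg3 x a ha, fun h => h ▸ hg2 x (h ▸ ha)⟩
    rw [Sym2.eq_iff, key _ h1, key _ h2, key _ h1, key _ h2]

variable [DecidableEq V]

theorem IsCompleteMinusCode.exists_adjMatrix_add_one (hc : c.Valid)
    (hG : G.IsCompleteMinusCode c) :
    ∃ g : V → ℕ, (∀ x, g x ≤ c.1) ∧ (∀ a < c.1, ∃ x, g x = a) ∧
      (c.1 < Fintype.card V → ∃ x, g x = c.1) ∧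
      G.rankAdjAddOne = (Matrix.of fun x y => (c.coadj (g x) (g y) : ℝ)).rank := by
  classical
  obtain ⟨g, h1, h2, h3, h4⟩ := hG.exists_index hc
  refine ⟨g, h1, h2, h3, ?_⟩
  unfold rankAdjAddOne
  congr 1
  ext x y
  have hxx : c.adj (g x) (g x) = false := by
    rw [← Bool.not_eq_true, adj_iff]
    rintro ⟨p, hp, h⟩
    have := (hc.2 p hp).1
    omega
  rw [Matrix.add_apply, adjMatrix_apply, Matrix.one_apply, Matrix.of_apply, coadj]
  by_cases hxy : x = y
  · subst hxy
    simp [hxx]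
  · cases h : c.adj (g x) (g y) <;> simp [h4, hxy, h]

/-- Vertices with the same neighbours in the deleted graph give equal rows and columns of `A + I`.
If `κ` sorts the labels into `k` such classes with representatives `ι`, then `A + I` is obtained
from a `k × k` matrix by repeating rows and columns. -/
theorem IsCompleteMinusCode.rankAdjAddOne_le (hc : c.Valid) (hG : G.IsCompleteMinusCode c)
    {k : ℕ} (κ : ℕ → Fin k) (ι : Fin k → ℕ)
    (h : ∀ a ≤ c.1, ∀ b ≤ c.1, c.coadj a b = c.coadj (ι (κ a)) (ι (κ b))) :
    G.rankAdjAddOne ≤ k := by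
  obtain ⟨g, h1, -, -, h4⟩ := hG.exists_adjMatrix_add_one hc
  have e : (Matrix.of fun x y => (c.coadj (g x) (g y) : ℝ)) =
      (Matrix.of fun i j => (c.coadj (ι i) (ι j) : ℝ)).submatrix (fun x => κ (g x))
        (fun x => κ (g x)) := by
    ext x y
    simp [h _ (h1 x) _ (h1 y)]
  rw [h4, e]
  exact (Matrix.rank_submatrix_le _ _ _).trans
    ((Matrix.rank_le_card_width _).trans_eq (Fintype.card_fin k))

/-- The rank is bounded below by an invertible `k × k` submatrix, with `N` as `d` times its inverse.
The label `c.1` may be used only if some vertex lies outside the deleted graph. -/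
theorem IsCompleteMinusCode.le_rankAdjAddOne (hc : c.Valid) (hG : G.IsCompleteMinusCode c)
    {k : ℕ} (ι : Fin k → ℕ)
    (hι : (∀ i, ι i < c.1) ∨ (c.1 < Fintype.card V ∧ ∀ i, ι i ≤ c.1))
    (N : Matrix (Fin k) (Fin k) ℤ) {d : ℤ} (hd : d ≠ 0)
    (h : (Matrix.of fun i j => c.coadj (ι i) (ι j)) * N = d • (1 : Matrix (Fin k) (Fin k) ℤ)) :
    k ≤ G.rankAdjAddOne := by
  obtain ⟨g, -, h2, h3, h4⟩ := hG.exists_adjMatrix_add_one hc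
  have hex : ∀ i, ∃ x, g x = ι i := by
    intro i
    rcases hι with hι | ⟨hs, hι⟩
    · exact h2 _ (hι i)
    · rcases (hι i).lt_or_eq with h | h
      · exact h2 _ h
      · rw [h]
        exact h3 hs
  choose r hr using hex
  set M : Matrix (Fin k) (Fin k) ℤ := Matrix.of fun i j => c.coadj (ι i) (ι j) with hM
  have hdet : (M.map (Int.castRingHom ℝ)).det ≠ 0 := by
    have h' := congrArg Matrix.det h
    rw [Matrix.det_mul, Matrix.det_smul, Matrix.det_one, mul_one] at h'
    have hM0 : M.det ≠ 0 := left_ne_zero_of_mul (h' ▸ pow_ne_zero _ hd)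
    have h5 : (M.map (Int.castRingHom ℝ)).det = (M.det : ℝ) :=
      ((Int.castRingHom ℝ).map_det M).symm
    rw [h5]
    exact_mod_cast hM0
  have e : M.map (Int.castRingHom ℝ) =
      (Matrix.of fun x y => (c.coadj (g x) (g y) : ℝ)).submatrix r r := by
    ext i j
    simp [hM, hr]
  have h6 := Matrix.rank_of_det_ne_zero hdet
  rw [Fintype.card_fin, e] at h6
  rw [h4]
  exact h6.symm.le.trans (Matrix.rank_submatrix_le _ _ _)

theorem IsCompleteMinusCode.rankAdjAddOne_k4MinusK2
    (hG : G.IsCompleteMinusCode EdgeCode.k4MinusK2) (hV : 4 < Fintype.card V) :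
    G.rankAdjAddOne = 4 := by
  refine le_antisymm (hG.rankAdjAddOne_le (by decide)
    (fun a => if a < 2 then 0 else if a = 2 then 1 else if a = 3 then 2 else 3) ![0, 2, 3, 4]
    (by decide)) ?_
  exact hG.le_rankAdjAddOne (by decide) ![0, 2, 3, 4] (Or.inr ⟨hV, by decide⟩)
    !![1, -1, -1, 1; -1, 1, -1, 1; -1, -1, 1, 1; 1, 1, 1, -1] (d := 2) (by decide)
    (by decide +kernel)

theorem IsCompleteMinusCode.rankAdjAddOne_k14AddK2
    (hG : G.IsCompleteMinusCode EdgeCode.k14AddK2) (hV : 7 < Fintype.card V) :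
    G.rankAdjAddOne = 5 := by
  refine le_antisymm (hG.rankAdjAddOne_le (by decide)
    (fun a => if a = 0 then 0 else if a < 5 then 1 else if a = 5 then 2 else if a = 6 then 3 else 4)
    ![0, 1, 5, 6, 7] (by decide +kernel)) ?_
  exact hG.le_rankAdjAddOne (by decide) ![0, 1, 5, 6, 7] (Or.inr ⟨hV, by decide⟩)
    !![0, -1, 0, 0, 1; -1, 0, 0, 0, 1; 0, 0, 0, -1, 1; 0, 0, -1, 0, 1; 1, 1, 1, 1, -3] (d := 1)
    (by decide) (by decide +kernel)

theorem IsCompleteMinusCode.rankAdjAddOne_c4AddK2_le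
    (hG : G.IsCompleteMinusCode EdgeCode.c4AddK2) : G.rankAdjAddOne ≤ 5 :=
  hG.rankAdjAddOne_le (by decide)
    (fun a => if a = 0 ∨ a = 2 then 0 else if a < 4 then 1 else if a = 4 then 2 else
      if a = 5 then 3 else 4)
    ![0, 1, 4, 5, 6] (by decide +kernel)

theorem IsCompleteMinusCode.le_rankAdjAddOne_p6
    (hG : G.IsCompleteMinusCode EdgeCode.p6) : 6 ≤ G.rankAdjAddOne :=
  hG.le_rankAdjAddOne (by decide) ![0, 1, 2, 3, 4, 5] (Or.inl (by decide))
    !![1, -2, 0, 3, 1, -2; -2, 1, 0, 0, 1, 1; 0, 0, 0, -3, 0, 3; 3, 0, -3, 0, 0, 0;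
      1, 1, 0, 0, 1, -2; -2, 1, 3, 0, -2, 1] (d := 3) (by decide) (by decide +kernel)

/-! ### The cospectral pair on seven vertices. -/

/-- `T` certifies that `S` is invertible over the reals, so the adjacency matrices are similar; with
integer entries both hypotheses are decidable. -/
theorem cospectral_of_intertwining {G H : SimpleGraph V} [DecidableRel G.Adj] [DecidableRel H.Adj]
    (S T : Matrix V V ℤ) {d : ℤ} (hd : d ≠ 0) (hT : S * T = d • (1 : Matrix V V ℤ))
    (hS : S * G.adjMatrix ℤ = H.adjMatrix ℤ * S) : Cospectral G H := by
  set φ := Int.castRingHom ℝ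
  have hmap : ∀ (K : SimpleGraph V) [DecidableRel K.Adj],
      (K.adjMatrix ℤ).map φ = K.adjMatrix ℝ := by
    intro K _
    ext x y
    by_cases h : K.Adj x y <;> simp [h]
  have hdet : IsUnit (S.map φ).det := by
    have h' := congrArg Matrix.det hT
    rw [Matrix.det_mul, Matrix.det_smul, Matrix.det_one, mul_one] at h'
    have hS0 : S.det ≠ 0 := left_ne_zero_of_mul (h' ▸ pow_ne_zero _ hd)
    have h5 : (S.map φ).det = (S.det : ℝ) := (φ.map_det S).symm
    rw [h5, isUnit_iff_ne_zero]
    exact_mod_cast hS0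
  have h := congrArg (fun M => M.map φ) hS
  simp only [Matrix.map_mul, hmap] at h
  have hG : G.adjMatrix ℝ = (S.map φ)⁻¹ * H.adjMatrix ℝ * S.map φ := by
    rw [mul_assoc, ← h, Matrix.nonsing_inv_mul_cancel_left _ _ hdet]
  rw [Cospectral, adjSpectrum_eq_roots, adjSpectrum_eq_roots, hG, Matrix.charpoly_mul_comm,
    ← mul_assoc, Matrix.mul_nonsing_inv _ hdet, one_mul]

theorem cospectral_toGraph_seven :
    Cospectral (EdgeCode.k4MinusK2.toGraph 7) (EdgeCode.k14AddK2.toGraph 7) :=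
  cospectral_of_intertwining
    -- This matrix intertwines the two adjacency matrices; the next one is 18 times its inverse.
    !![-1, -1, 0, 0, 1, 1, 1; 1, 0, 0, 0, 2, 1, 0; 2, -1, 0, 0, 0, 2, 1; -1, 2, 0, 0, 1, 0, 2;
      0, 1, 0, 0, 1, 1, 1; 1, 1, 2, 1, 0, 0, 0; 1, 1, 1, 2, 0, 0, 0]
    !![-6, 6, 6, 6, -12, 0, 0; -6, -3, -3, -3, 15, 0, 0; 4, -1, -1, -1, -1, 12, -6;
      4, -1, -1, -1, -1, -6, 12; 2, 10, -2, 4, -8, 0, 0; 2, -8, -2, -14, 28, 0, 0;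
      2, 1, 7, 13, -17, 0, 0]
    (d := 18) (by decide) (by decide +kernel) (by decide +kernel)

/-- Vertex 6 lies outside the copy of `K_4 ∖ K_2` and so is adjacent to all others, whereas `K_{1,4}
+ K_2` touches all seven vertices. -/
theorem isEmpty_iso_toGraph_seven :
    IsEmpty (EdgeCode.k4MinusK2.toGraph 7 ≃g EdgeCode.k14AddK2.toGraph 7) := by
  refine ⟨fun e => ?_⟩
  have h1 : ∀ y, y ≠ 6 → (EdgeCode.k4MinusK2.toGraph 7).Adj 6 y := by decide +kernel
  have h2 : ∀ x, ∃ y, y ≠ x ∧ ¬ (EdgeCode.k14AddK2.toGraph 7).Adj x y := by decide +kernel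
  obtain ⟨y, hy, hn⟩ := h2 (e 6)
  refine hn ?_
  have := e.map_adj_iff.mpr (h1 (e.symm y) fun h => hy (by rw [← h, e.apply_symm_apply]))
  rwa [e.apply_symm_apply] at this

end SimpleGraph

/-! ### Comparison of the traces of all pairs of representatives. -/

namespace EdgeCode
-- These terms of the trace formulas depend only on `m`, so they cancel in a comparison.
theorem walks_reps : ∀ m ≤ 5, ∀ c ∈ reps m, (c.walks 0).length = 2 * m ∧
    closed (c.walks 0) = 0 ∧ closed (c.walks 1) = 2 * m := by
  decide +kernel

theorem nodup_reps : ∀ m ≤ 5, (reps m).Nodup := by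
  decide +kernel

/-- Either `c = d`, or the traces of the third and fourth power of the adjacency matrices of `K_n`
minus `c` and of `K_n` minus `d` do not both agree for any admissible `n`, the traces being equal
only if `3 * a` is the difference of the closed 3-walks and `4 * n * a = b`. -/
def separated (c d : EdgeCode) : Bool :=
  let a : ℤ := (c.walks 1).length - (d.walks 1).length
  let b : ℤ := 4 * ((c.walks 2).length - (d.walks 2).length) -
    (closed (c.walks 3) - closed (d.walks 3))
  decide (c = d) || decide (3 * a ≠ closed (c.walks 2) - closed (d.walks 2)) ||
    if a = 0 then decide (b ≠ 0) else
      decide (4 * (b / (4 * a)) * a ≠ b) || decide (b / (4 * a) < max c.1 d.1)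

/-- The pairs of codes that are not separated. -/
def exceptions : List (EdgeCode × EdgeCode) :=
  [(k4MinusK2, k14AddK2), (k14AddK2, k4MinusK2), (p6, c4AddK2), (c4AddK2, p6)]

theorem separated_or_mem_exceptions : ∀ m ≤ 5, (reps m).all (fun c => (reps m).all fun d =>
    separated c d || exceptions.contains (c, d)) = true := by
  decide +kernel

theorem eq_or_exception {n m : ℕ} (hm : m ≤ 5) {c d : EdgeCode} (hc : c ∈ reps m)
    (hd : d ∈ reps m) (hcn : c.1 ≤ n) (hdn : d.1 ≤ n) (h3 : traceThree n c = traceThree n d)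
    (h4 : traceFour n c = traceFour n d) :
    c = d ∨ (n = 7 ∧ ((c = k4MinusK2 ∧ d = k14AddK2) ∨ (c = k14AddK2 ∧ d = k4MinusK2))) ∨
      (c = p6 ∧ d = c4AddK2) ∨ (c = c4AddK2 ∧ d = p6) := by
  have hs := separated_or_mem_exceptions m hm
  simp only [List.all_eq_true] at hs
  have hs := hs c hc d hd
  obtain ⟨hc1, hc2, hc3⟩ := walks_reps m hm c hc
  obtain ⟨hd1, hd2, hd3⟩ := walks_reps m hm d hd
  simp only [traceThree, traceFour, hc1, hc2, hc3, hd1, hd2, hd3] at h3 h4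
  set a : ℤ := (c.walks 1).length - (d.walks 1).length with ha
  set b : ℤ := 4 * ((c.walks 2).length - (d.walks 2).length) -
    (closed (c.walks 3) - closed (d.walks 3)) with hb
  have e3 : 3 * a = closed (c.walks 2) - closed (d.walks 2) := by rw [ha]; linarith
  -- The difference of the fourth traces also contains `-12 * a` and four times the difference of
  -- the closed 3-walks; these cancel by `e3`.
  have e4 : n * (4 * a) = b := by rw [ha, hb]; linarith
  rw [Bool.or_eq_true] at hs
  rcases hs with hs | hs
  · left
    simp only [separated, ← ha, ← hb, Bool.or_eq_true, decide_eq_true_eq] at hs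
    rcases hs with (hs | hs) | hs
    · exact hs
    · exact absurd e3 hs
    · exfalso
      split_ifs at hs with h0
      · rw [decide_eq_true_eq] at hs
        rw [h0] at e4
        exact hs (by linarith)
      -- Since `n` solves the equation, the integer quotient tested in `separated` is `n` itself.
      · have hq : b / (4 * a) = n := by
          rw [← e4, Int.mul_ediv_cancel _ (by omega)]
        rw [hq, Bool.or_eq_true, decide_eq_true_eq, decide_eq_true_eq] at hs
        rcases hs with hs | hs
        · exact hs (by linarith)
        · have hs : n < max c.1 d.1 := by exact_mod_cast hs
          omega
  · right
    simp only [exceptions, List.contains_iff_mem, List.mem_cons, Prod.mk.injEq, List.not_mem_nil,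
      or_false] at hs
    -- Here `a = 4` and `b = 112` up to a common sign, so `16 * n = 112`, which forces `n = 7`.
    have f1 : (k4MinusK2.walks 1).length = 26 ∧ (k4MinusK2.walks 2).length = 66 ∧
        closed (k4MinusK2.walks 3) = 50 := by decide +kernel
    have f2 : (k14AddK2.walks 1).length = 22 ∧ (k14AddK2.walks 2).length = 34 ∧
        closed (k14AddK2.walks 3) = 34 := by decide +kernel
    rcases hs with ⟨rfl, rfl⟩ | ⟨rfl, rfl⟩ | hs | hs
    · rw [f1.1, f2.1] at ha
      rw [f1.2.1, f2.2.1, f1.2.2, f2.2.2] at hb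
      rw [ha, hb] at e4
      exact Or.inl ⟨by omega, by simp⟩
    · rw [f1.1, f2.1] at ha
      rw [f1.2.1, f2.2.1, f1.2.2, f2.2.2] at hb
      rw [ha, hb] at e4
      exact Or.inl ⟨by omega, by simp⟩
    · exact Or.inr (Or.inl hs)
    · exact Or.inr (Or.inr hs)

theorem walks_p6 : (p6.walks 0).length = 10 ∧ (p6.walks 1).length = 18 ∧
    (p6.walks 2).length = 32 ∧ closed (p6.walks 0) = 0 ∧ closed (p6.walks 1) = 10 ∧
    closed (p6.walks 2) = 0 ∧ closed (p6.walks 3) = 26 := by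
  decide +kernel

theorem walks_c4AddK2 : (c4AddK2.walks 0).length = 10 ∧ (c4AddK2.walks 1).length = 18 ∧
    (c4AddK2.walks 2).length = 34 ∧ closed (c4AddK2.walks 0) = 0 ∧ closed (c4AddK2.walks 1) = 10 ∧
    closed (c4AddK2.walks 2) = 0 ∧ closed (c4AddK2.walks 3) = 34 := by
  decide +kernel

theorem traceThree_p6 (n : ℤ) : traceThree n p6 = traceThree n c4AddK2 := by
  simp only [traceThree, walks_p6, walks_c4AddK2]

/-- The 2-walks agree in number, and the deficit of two 3-walks of `P_6` is balanced by its deficit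
of eight closed 4-walks, so `a = b = 0`. -/
theorem traceFour_p6 (n : ℤ) : traceFour n p6 = traceFour n c4AddK2 := by
  simp only [traceFour, walks_p6, walks_c4AddK2]
  push_cast
  ring

end EdgeCode

/-! ### From codes to the named graphs, and the final statements. -/

namespace SimpleGraph

section

variable {V : Type*} {G : SimpleGraph V}

theorem isCompleteMinusGraph_k4MinusK2_iff :
    G.IsCompleteMinusGraph k4MinusK2 ↔ G.IsCompleteMinusCode EdgeCode.k4MinusK2 := by
  refine isCompleteMinusGraph_iff_code (by decide) (Equiv.refl (Fin 4)) (by decide) ?_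
  simp only [k4MinusK2, completeGraph_eq_top, deleteEdges_adj, top_adj, Set.mem_singleton_iff]
  decide +kernel

theorem isCompleteMinusGraph_p6_iff :
    G.IsCompleteMinusGraph p6 ↔ G.IsCompleteMinusCode EdgeCode.p6 := by
  refine isCompleteMinusGraph_iff_code (by decide) (Equiv.refl (Fin 6)) (by decide) ?_
  simp only [p6, pathGraph_adj]
  decide +kernel

theorem isCompleteMinusGraph_k14AddK2_iff :
    G.IsCompleteMinusGraph k14AddK2 ↔ G.IsCompleteMinusCode EdgeCode.k14AddK2 := by
  refine isCompleteMinusGraph_iff_code (by decide)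
    ((Equiv.sumCongr finSumFinEquiv (Equiv.refl (Fin 2))).trans finSumFinEquiv) (by decide) ?_
  rintro ((x | x) | x) ((y | y) | y) <;>
    simp only [k14AddK2, sum_adj, completeBipartiteGraph_adj, completeGraph_eq_top, top_adj] <;>
    revert x y <;> decide +kernel

theorem isCompleteMinusGraph_c4AddK2_iff :
    G.IsCompleteMinusGraph c4AddK2 ↔ G.IsCompleteMinusCode EdgeCode.c4AddK2 := by
  refine isCompleteMinusGraph_iff_code (by decide) (finSumFinEquiv (m := 4) (n := 2)) (by decide) ?_
  rintro (x | x) (y | y) <;>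
    simp only [c4AddK2, sum_adj, cycleGraph_adj, completeGraph_eq_top, top_adj] <;>
    revert x y <;> decide +kernel

end

theorem IsCompleteMinusEdges.card_edgeFinset_add {V : Type*} [Fintype V] [DecidableEq V]
    {G : SimpleGraph V} [DecidableRel G.Adj] {m : ℕ} (hG : G.IsCompleteMinusEdges m) :
    G.edgeFinset.card + m = (Fintype.card V).choose 2 := by
  obtain ⟨S, hS, rfl, h⟩ := hG
  have e : G.edgeFinset = (⊤ : SimpleGraph V).edgeFinset \ S := by
    ext z
    rw [mem_edgeFinset, h, edgeSet_deleteEdges]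
    simp
  have hS' : S ⊆ (⊤ : SimpleGraph V).edgeFinset := fun z hz => mem_edgeFinset.mpr (hS hz)
  rw [e, Finset.card_sdiff_add_card_eq_card hS', card_edgeFinset_top_eq_card_choose_two]

theorem trace_adjMatrix_sq {V : Type*} [Fintype V] [DecidableEq V] (G : SimpleGraph V)
    [DecidableRel G.Adj] : (G.adjMatrix ℝ ^ 2).trace = 2 * G.edgeFinset.card := by
  rw [pow_two, Matrix.trace]
  simp only [Matrix.diag_apply, adjMatrix_mul_self_apply_self]
  rw [← Nat.cast_sum, sum_degrees_eq_twice_card_edges]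
  push_cast
  rfl

theorem isCompleteMinusEdges_compl {V : Type*} [Fintype V] [DecidableEq V] (G : SimpleGraph V)
    [DecidableRel G.Adj] : G.IsCompleteMinusEdges Gᶜ.edgeFinset.card := by
  refine ⟨Gᶜ.edgeFinset, ?_, rfl, ?_⟩
  · rw [coe_edgeFinset]
    exact edgeSet_mono le_top
  · ext x y
    simp only [coe_edgeFinset, completeGraph_eq_top, deleteEdges_adj, top_adj, mem_edgeSet,
      compl_adj]
    have := G.ne_of_adj (a := x) (b := y)
    tauto

/-- The trace of `A ^ 2` is twice the number of edges, hence the complements have equally many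
edges. -/
theorem Cospectral.isCompleteMinusEdges {V : Type*} [Fintype V] [DecidableEq V]
    {G H : SimpleGraph V} {m : ℕ} (h : Cospectral G H) (hG : G.IsCompleteMinusEdges m) :
    H.IsCompleteMinusEdges m := by
  classical
  have h2 := h.trace_pow_eq 2
  rw [trace_adjMatrix_sq, trace_adjMatrix_sq] at h2
  have h3 : G.edgeFinset.card = H.edgeFinset.card := by
    exact_mod_cast mul_left_cancel₀ two_ne_zero h2
  have hH := H.isCompleteMinusEdges_compl
  have e1 := hG.card_edgeFinset_add
  have e2 := hH.card_edgeFinset_add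
  have : Hᶜ.edgeFinset.card = m := by omega
  rwa [this] at hH

theorem triangleCount_eq_iff {V : Type*} [Fintype V] [DecidableEq V] {G H : SimpleGraph V}
    [DecidableRel G.Adj] [DecidableRel H.Adj] : G.triangleCount = H.triangleCount ↔
      (G.adjMatrix ℝ ^ 3).trace = (H.adjMatrix ℝ ^ 3).trace := by
  rw [← six_mul_triangleCount_eq_trace, ← six_mul_triangleCount_eq_trace]
  norm_num

theorem closedFourWalkCount_eq_iff {V : Type*} [Fintype V] [DecidableEq V] {G H : SimpleGraph V}
    [DecidableRel G.Adj] [DecidableRel H.Adj] : G.closedFourWalkCount = H.closedFourWalkCount ↔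
      (G.adjMatrix ℝ ^ 4).trace = (H.adjMatrix ℝ ^ 4).trace := by
  rw [← closedFourWalkCount_eq_trace, ← closedFourWalkCount_eq_trace]
  norm_num

theorem Cospectral.counts_eq {V : Type*} [Fintype V] [DecidableEq V] {G H : SimpleGraph V}
    (h : Cospectral G H) :
    G.triangleCount = H.triangleCount ∧ G.closedFourWalkCount = H.closedFourWalkCount := by
  classical
  exact ⟨triangleCount_eq_iff.mpr (h.trace_pow_eq 3),
    closedFourWalkCount_eq_iff.mpr (h.trace_pow_eq 4)⟩

theorem counts_eq_iff {V : Type*} [Fintype V] [DecidableEq V] {G H : SimpleGraph V}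
    {c d : EdgeCode} (hc : c.Valid) (hd : d.Valid) (hG : G.IsCompleteMinusCode c)
    (hH : H.IsCompleteMinusCode d) :
    (G.triangleCount = H.triangleCount ∧ G.closedFourWalkCount = H.closedFourWalkCount) ↔
      EdgeCode.traceThree (Fintype.card V) c = EdgeCode.traceThree (Fintype.card V) d ∧
      EdgeCode.traceFour (Fintype.card V) c = EdgeCode.traceFour (Fintype.card V) d := by
  classical
  rw [triangleCount_eq_iff, closedFourWalkCount_eq_iff, hG.trace_pow_three hc,
    hH.trace_pow_three hd, hG.trace_pow_four hc, hH.trace_pow_four hd, Int.cast_inj, Int.cast_inj]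

theorem nonempty_iso_or_exception {n m : ℕ} (hm : m ≤ 5) {G G' : SimpleGraph (Fin n)}
    (hG : G.IsCompleteMinusEdges m) (hG' : G'.IsCompleteMinusEdges m)
    (h : G.triangleCount = G'.triangleCount ∧ G.closedFourWalkCount = G'.closedFourWalkCount) :
    Nonempty (G ≃g G') ∨ (n = 7 ∧ IsCompleteMinusPair G G' k4MinusK2 k14AddK2) ∨
      IsCompleteMinusPair G G' p6 c4AddK2 := by
  -- A labelling `ℕ → V` needs a vertex, so the empty graph is treated apart.
  rcases Nat.eq_zero_or_pos n with rfl | hn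
  · have : G = G' := by
      ext x
      exact x.elim0
    exact Or.inl ⟨this ▸ Iso.refl⟩
  · have : NeZero n := ⟨hn.ne'⟩
    obtain ⟨c, hc, hGc⟩ := hG.exists_code hm
    obtain ⟨d, hd, hGd⟩ := hG'.exists_code hm
    have hcv := (EdgeCode.valid_of_mem_reps m hm c hc).1
    have hdv := (EdgeCode.valid_of_mem_reps m hm d hd).1
    rw [counts_eq_iff hcv hdv hGc hGd, Fintype.card_fin] at h
    simp only [IsCompleteMinusPair, isCompleteMinusGraph_k4MinusK2_iff,
      isCompleteMinusGraph_k14AddK2_iff, isCompleteMinusGraph_p6_iff,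
      isCompleteMinusGraph_c4AddK2_iff]
    have hcn : c.1 ≤ n := by simpa using hGc.card_le
    have hdn : d.1 ≤ n := by simpa using hGd.card_le
    rcases EdgeCode.eq_or_exception hm hc hd hcn hdn h.1 h.2 with
      rfl | ⟨h7, ⟨rfl, rfl⟩ | ⟨rfl, rfl⟩⟩ | ⟨rfl, rfl⟩ | ⟨rfl, rfl⟩
    · exact Or.inl (hGc.nonempty_iso hcv hGd)
    · exact Or.inr (Or.inl ⟨h7, Or.inl ⟨hGc, hGd⟩⟩)
    · exact Or.inr (Or.inl ⟨h7, Or.inr ⟨hGc, hGd⟩⟩)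
    · exact Or.inr (Or.inr (Or.inl ⟨hGc, hGd⟩))
    · exact Or.inr (Or.inr (Or.inr ⟨hGc, hGd⟩))

theorem Cospectral.rankAdjAddOne_eq {V : Type*} [Fintype V] [DecidableEq V]
    {G H : SimpleGraph V} (h : Cospectral G H) : G.rankAdjAddOne = H.rankAdjAddOne := by
  have e1 := G.multNegOne_add_rankAdjAddOne
  have e2 := H.multNegOne_add_rankAdjAddOne
  have e3 := h.multNegOne_eq
  omega

theorem rankAdjAddOne_lt_of_p6_of_c4AddK2 {V : Type*} [Fintype V] [DecidableEq V]
    {G H : SimpleGraph V} (hG : G.IsCompleteMinusGraph p6) (hH : H.IsCompleteMinusGraph c4AddK2) :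
    H.rankAdjAddOne < G.rankAdjAddOne := by
  have h1 := (isCompleteMinusGraph_p6_iff.mp hG).le_rankAdjAddOne_p6
  have h2 := (isCompleteMinusGraph_c4AddK2_iff.mp hH).rankAdjAddOne_c4AddK2_le
  omega

theorem Cospectral.not_isCompleteMinusPair {V : Type*} [Fintype V] [DecidableEq V]
    {G H : SimpleGraph V} (h : Cospectral G H) : ¬ IsCompleteMinusPair G H p6 c4AddK2 := by
  have e := h.rankAdjAddOne_eq
  rintro (⟨h1, h2⟩ | ⟨h1, h2⟩)
  · exact (rankAdjAddOne_lt_of_p6_of_c4AddK2 h1 h2).ne' e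
  · exact (rankAdjAddOne_lt_of_p6_of_c4AddK2 h2 h1).ne e

theorem cospectral_and_isEmpty_iso_of_seven {G G' : SimpleGraph (Fin 7)}
    (hG : G.IsCompleteMinusGraph k4MinusK2) (hG' : G'.IsCompleteMinusGraph k14AddK2) :
    Cospectral G G' ∧ ¬ Nonempty (G ≃g G') := by
  rw [isCompleteMinusGraph_k4MinusK2_iff] at hG
  rw [isCompleteMinusGraph_k14AddK2_iff] at hG'
  obtain ⟨e⟩ := hG.nonempty_iso (by decide)
    (EdgeCode.isCompleteMinusCode_toGraph (by decide) (by decide) (by decide))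
  obtain ⟨e'⟩ := hG'.nonempty_iso (by decide)
    (EdgeCode.isCompleteMinusCode_toGraph (by decide) (by decide) (by decide))
  refine ⟨e.cospectral.trans (cospectral_toGraph_seven.trans e'.cospectral.symm), ?_⟩
  rintro ⟨i⟩
  exact isEmpty_iso_toGraph_seven.false ((e.symm.trans i).trans e')

/-- All representatives fit since `m` edges meet at most `2 * m` vertices. Isomorphic ones have
equal counts, so they coincide or form an exceptional pair; `hn7` rules out one pair and the rank of
`A + I` the other. -/
theorem numCompleteMinusEdges {n m : ℕ} (hm : m ≤ 5) (hn : 2 * m ≤ n) (hn7 : 7 < n) :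
    NumCompleteMinusEdges n m (EdgeCode.reps m).length := by
  have hv := EdgeCode.valid_of_mem_reps m hm
  have hmem : ∀ i : Fin (EdgeCode.reps m).length, (EdgeCode.reps m).get i ∈ EdgeCode.reps m :=
    fun i => List.get_mem _ _
  have hcode : ∀ c ∈ EdgeCode.reps m, (c.toGraph n).IsCompleteMinusCode c := fun c hc =>
    EdgeCode.isCompleteMinusCode_toGraph (by omega) (hv c hc).1 ((hv c hc).2.2.trans hn)
  refine ⟨fun i => ((EdgeCode.reps m).get i).toGraph n, fun i => ?_, fun i j ⟨e⟩ => ?_,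
    fun G hG => ?_⟩
  · have := (hcode _ (hmem i)).isCompleteMinusEdges (hv _ (hmem i)).1
    rwa [(hv _ (hmem i)).2.1] at this
  · have hnd := EdgeCode.nodup_reps m hm
    have hi := hcode _ (hmem i)
    have hj := hcode _ (hmem j)
    have h := (counts_eq_iff (hv _ (hmem i)).1 (hv _ (hmem j)).1 hi hj).mp e.cospectral.counts_eq
    rw [Fintype.card_fin] at h
    have hne := e.cospectral.not_isCompleteMinusPair
    simp only [IsCompleteMinusPair, isCompleteMinusGraph_p6_iff,
      isCompleteMinusGraph_c4AddK2_iff] at hne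
    rcases EdgeCode.eq_or_exception hm (hmem i) (hmem j) ((hv _ (hmem i)).2.2.trans hn)
      ((hv _ (hmem j)).2.2.trans hn) h.1 h.2 with h | ⟨h, -⟩ | ⟨h, h'⟩ | ⟨h, h'⟩
    · exact (List.nodup_iff_injective_get.mp hnd) h
    · omega
    · exact absurd (Or.inl ⟨h ▸ hi, h' ▸ hj⟩) hne
    · exact absurd (Or.inr ⟨h ▸ hi, h' ▸ hj⟩) hne
  · have : NeZero n := ⟨by omega⟩
    obtain ⟨c, hc, hGc⟩ := hG.exists_code hm
    obtain ⟨i, rfl⟩ := List.get_of_mem hc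
    exact ⟨i, hGc.nonempty_iso (hv _ hc).1 (hcode _ hc)⟩

/-- For `n = 7` each exceptional graph is a cospectral mate of the other. In all other cases a mate
has the same `n`, `m` and counts, and the pair `P_6`, `C_4 + K_2` is excluded by rank. -/
theorem isDS_iff {n m : ℕ} (hm : m ≤ 5) {G : SimpleGraph (Fin n)}
    (hG : G.IsCompleteMinusEdges m) :
    G.IsDS ↔ ¬ (n = 7 ∧ (G.IsCompleteMinusGraph k4MinusK2 ∨
      G.IsCompleteMinusGraph k14AddK2)) := by
  constructor
  · rintro hDS ⟨rfl, h | h⟩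
    · obtain ⟨h1, h2⟩ := cospectral_and_isEmpty_iso_of_seven h
        (isCompleteMinusGraph_k14AddK2_iff.mpr (EdgeCode.isCompleteMinusCode_toGraph (n := 7)
          (by decide) (by decide) (by decide)))
      exact h2 (hDS _ _ h1)
    · obtain ⟨h1, h2⟩ := cospectral_and_isEmpty_iso_of_seven
        (isCompleteMinusGraph_k4MinusK2_iff.mpr (EdgeCode.isCompleteMinusCode_toGraph (n := 7)
          (by decide) (by decide) (by decide))) h
      exact h2 ((hDS _ _ h1.symm).map Iso.symm)
  · intro hex k H hH
    obtain rfl : n = k := by simpa using hH.card_eq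
    rcases nonempty_iso_or_exception hm hG (hH.isCompleteMinusEdges hG) hH.counts_eq with
      h | ⟨h7, ⟨h, -⟩ | ⟨h, -⟩⟩ | h
    · exact h
    · exact absurd ⟨h7, Or.inl h⟩ hex
    · exact absurd ⟨h7, Or.inr h⟩ hex
    · exact absurd h hH.not_isCompleteMinusPair

theorem counts_eq_of_p6_of_c4AddK2 {V : Type*} [Fintype V] [DecidableEq V]
    {G H : SimpleGraph V} (hG : G.IsCompleteMinusGraph p6) (hH : H.IsCompleteMinusGraph c4AddK2) :
    G.triangleCount = H.triangleCount ∧ G.closedFourWalkCount = H.closedFourWalkCount :=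
  (counts_eq_iff (by decide) (by decide) (isCompleteMinusGraph_p6_iff.mp hG)
    (isCompleteMinusGraph_c4AddK2_iff.mp hH)).mpr
    ⟨EdgeCode.traceThree_p6 _, EdgeCode.traceFour_p6 _⟩

theorem nonempty_iso_of_four {n : ℕ} {G G' : SimpleGraph (Fin n)}
    (hG : G.IsCompleteMinusEdges 4) (hG' : G'.IsCompleteMinusEdges 4)
    (h3 : G.triangleCount = G'.triangleCount)
    (h4 : G.closedFourWalkCount = G'.closedFourWalkCount) : Nonempty (G ≃g G') := by
  have key : ∀ c ∈ [EdgeCode.k4MinusK2, EdgeCode.k14AddK2, EdgeCode.p6, EdgeCode.c4AddK2],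
      c.Valid ∧ c.2.length = 5 := by decide
  -- All four exceptional graphs have five edges, so none arises when four are deleted.
  have hne : ∀ c ∈ [EdgeCode.k4MinusK2, EdgeCode.k14AddK2, EdgeCode.p6, EdgeCode.c4AddK2],
      ¬ G.IsCompleteMinusCode c := by
    classical
    intro c hc hGc
    have h5 := hGc.isCompleteMinusEdges (key c hc).1
    rw [(key c hc).2] at h5
    have e4 := hG.card_edgeFinset_add
    have e5 := h5.card_edgeFinset_add
    omega
  rcases nonempty_iso_or_exception (by norm_num) hG hG' ⟨h3, h4⟩ with
    h | ⟨-, ⟨h, -⟩ | ⟨h, -⟩⟩ | ⟨h, -⟩ | ⟨h, -⟩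
  · exact h
  · exact absurd (isCompleteMinusGraph_k4MinusK2_iff.mp h) (hne _ (by simp))
  · exact absurd (isCompleteMinusGraph_k14AddK2_iff.mp h) (hne _ (by simp))
  · exact absurd (isCompleteMinusGraph_p6_iff.mp h) (hne _ (by simp))
  · exact absurd (isCompleteMinusGraph_c4AddK2_iff.mp h) (hne _ (by simp))

end SimpleGraph

theorem mainTheorem1 :
    -- `K_n` minus at most five edges is DS, precisely apart from the two exceptional graphs
    (∀ (n m : ℕ) (G : SimpleGraph (Fin n)), m ≤ 5 → G.IsCompleteMinusEdges m →
      (G.IsDS ↔ ¬ (n = 7 ∧ (G.IsCompleteMinusGraph SimpleGraph.k4MinusK2 ∨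
        G.IsCompleteMinusGraph SimpleGraph.k14AddK2)))) ∧
    -- the two exceptional graphs are cospectral and not isomorphic
    (∀ G G' : SimpleGraph (Fin 7), G.IsCompleteMinusGraph SimpleGraph.k4MinusK2 →
      G'.IsCompleteMinusGraph SimpleGraph.k14AddK2 →
      SimpleGraph.Cospectral G G' ∧ ¬ Nonempty (G ≃g G')) ∧
    -- four deleted edges: eleven cases, separated by triangles and closed 4-walks
    (∀ n : ℕ, 8 ≤ n → SimpleGraph.NumCompleteMinusEdges n 4 11) ∧
    (∀ (n : ℕ) (G G' : SimpleGraph (Fin n)), G.IsCompleteMinusEdges 4 →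
      G'.IsCompleteMinusEdges 4 → G.triangleCount = G'.triangleCount →
      G.closedFourWalkCount = G'.closedFourWalkCount → Nonempty (G ≃g G')) ∧
    -- five deleted edges: 26 cases, separated in the same way apart from two pairs
    (∀ n : ℕ, 10 ≤ n → SimpleGraph.NumCompleteMinusEdges n 5 26) ∧
    (∀ (n : ℕ) (G G' : SimpleGraph (Fin n)), G.IsCompleteMinusEdges 5 →
      G'.IsCompleteMinusEdges 5 → ¬ Nonempty (G ≃g G') →
      ((G.triangleCount = G'.triangleCount ∧ G.closedFourWalkCount = G'.closedFourWalkCount) ↔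
        ((n = 7 ∧ SimpleGraph.IsCompleteMinusPair G G'
            SimpleGraph.k4MinusK2 SimpleGraph.k14AddK2) ∨
          SimpleGraph.IsCompleteMinusPair G G' SimpleGraph.p6 SimpleGraph.c4AddK2))) ∧
    -- the first pair is separated by the eigenvalue `-1` for `n > 7`
    (∀ (n : ℕ) (G G' : SimpleGraph (Fin n)), 7 < n →
      G.IsCompleteMinusGraph SimpleGraph.k4MinusK2 →
      G'.IsCompleteMinusGraph SimpleGraph.k14AddK2 →
      (G.rankAdjAddOne = 4 ∧ G.multNegOne = n - 4) ∧
      (G'.rankAdjAddOne = 5 ∧ G'.multNegOne = n - 5)) ∧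
    -- the second pair is separated by the eigenvalue `-1` for all `n ≥ 6`
    (∀ (n : ℕ) (G G' : SimpleGraph (Fin n)), 6 ≤ n →
      G.IsCompleteMinusGraph SimpleGraph.p6 → G'.IsCompleteMinusGraph SimpleGraph.c4AddK2 →
      G.rankAdjAddOne ≠ G'.rankAdjAddOne ∧ G.multNegOne ≠ G'.multNegOne) := by
  refine ⟨fun n m G hm hG => SimpleGraph.isDS_iff hm hG,
    fun G G' hG hG' => SimpleGraph.cospectral_and_isEmpty_iso_of_seven hG hG',
    fun n hn => SimpleGraph.numCompleteMinusEdges (m := 4) (by norm_num) hn hn,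
    fun n G G' hG hG' h3 h4 => ?_,
    fun n hn => SimpleGraph.numCompleteMinusEdges (m := 5) (by norm_num) hn (by omega),
    fun n G G' hG hG' hne => ⟨fun h => ?_, fun h => ?_⟩,
    fun n G G' hn hG hG' => ?_, fun n G G' hn hG hG' => ?_⟩
  · exact SimpleGraph.nonempty_iso_of_four hG hG' h3 h4
  · exact (SimpleGraph.nonempty_iso_or_exception (by norm_num) hG hG' h).resolve_left hne
  · rcases h with ⟨rfl, ⟨h, h'⟩ | ⟨h, h'⟩⟩ | ⟨h, h'⟩ | ⟨h, h'⟩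
    · exact (SimpleGraph.cospectral_and_isEmpty_iso_of_seven h h').1.counts_eq
    · exact SimpleGraph.Cospectral.counts_eq
        (SimpleGraph.cospectral_and_isEmpty_iso_of_seven h' h).1.symm
    · exact SimpleGraph.counts_eq_of_p6_of_c4AddK2 h h'
    · have := SimpleGraph.counts_eq_of_p6_of_c4AddK2 h' h
      exact ⟨this.1.symm, this.2.symm⟩
  · have e := G.multNegOne_add_rankAdjAddOne
    have e' := G'.multNegOne_add_rankAdjAddOne
    have h := (SimpleGraph.isCompleteMinusGraph_k4MinusK2_iff.mp hG).rankAdjAddOne_k4MinusK2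
      (by rw [Fintype.card_fin]; omega)
    have h' := (SimpleGraph.isCompleteMinusGraph_k14AddK2_iff.mp hG').rankAdjAddOne_k14AddK2
      (by rwa [Fintype.card_fin])
    rw [Fintype.card_fin] at e e'
    omega
  · have e := G.multNegOne_add_rankAdjAddOne
    have e' := G'.multNegOne_add_rankAdjAddOne
    have h := SimpleGraph.rankAdjAddOne_lt_of_p6_of_c4AddK2 hG hG'
    omega
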